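/- Let $M$ be a smooth manifold (finite-dimensional, without boundary, Hausdorff, second countable) with a smooth foliation $\mathcal{F}$ of dimension $p$ and codimension $q$, and let $\pi\colon M\to M/\mathcal{F}$ be the projection onto the space of leaves. A *tangential path* is a smooth path $\mu\colon[0,1]\to M$ whose velocity is everywhere tangent to $\mathcal{F}$. A *diffeology* $\mathcal{D}$ on a set $X$ is a family of maps (*plots*) $\alpha\colon U\to X$, with $U$ open in some $\mathbb{R}^n$, $n\ge 0$, which contains all constant maps, is closed under $\alpha\mapsto\alpha\circ h$ for every smooth map $h\colon V\to U$ from an open subset $V$ of some $\mathbb{R}^k$, and is local. A *$\mathcal{D}$-differential form* of degree $r$ is a family $\theta=\{\theta_\alpha\}_{\alpha\in\mathcal{D}}$ of smooth $r$-forms $\theta_\alpha\in\Omega^r(U)$ with $\theta_{\alpha\circ h}=h^*\theta_\alpha$ for all such $h$. With $d\theta=\{d\theta_\alpha\}$ these form a complex $(\Omega(\mathcal{D}),d)$ of real vector spaces, whose cohomology is $H(\mathcal{D})$. Let $\mathcal{D}_\mathcal{F}$ be the quotient diffeology on $M/\mathcal{F}$: its plots are the maps $\alpha\colon U\to M/\mathcal{F}$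 such that every $t\in U$ has an open neighbourhood $V\subset U$ with $\alpha|_V=\pi\circ\beta$ for some smooth $\beta\colon V\to M$. A form $\omega\in\Omega^r(M)$ is *basic* if $i_X\omega=0$ and $i_X d\omega=0$ for every smooth vector field $X$ on $M$ tangent to $\mathcal{F}$. The basic forms are a complex $(\Omega_b(M,\mathcal{F}),d)$, whose cohomology is the basic cohomology $H_b(M,\mathcal{F})$. The foliation $\mathcal{F}$ is a *$Q$-foliation* if it has the $C^\infty$ tubular property: for any manifold $X$ with base point $x$, any smooth maps $\beta,\gamma\colon X\to M$ with $\pi\circ\beta=\pi\circ\gamma$, and any tangential path $\mu$ with $\mu(0)=\beta(x)$ and $\mu(1)=\gamma(x)$, there are an open neighbourhood $U\subset X$ of $x$ and a smooth map $H\colon U\times[0,1]\to M$ such that $H(y,0)=\beta(y)$ and $H(y,1)=\gamma(y)$ for all $y\in U$, $H(x,t)=\mu(t)$ for all $t\in[0,1]$, and for each $y\in U$ the path $t\mapsto H(y,t)$ is tangential. **Theorem.** Let $\mathcal{F}$ be a $Q$-foliation on $M$. Then there is a morphism of complexes $B\colon\Omega(\mathcal{D}_\mathcal{F})\to\Omega_b(M,\mathcal{F})$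 such that $\beta^*(B\theta)=\theta_{\pi\circ\beta}$ for every $\theta\in\Omega(\mathcal{D}_\mathcal{F})$, every open subset $U$ of some $\mathbb{R}^n$ and every smooth map $\beta\colon U\to M$. It is bijective in every degree, and it induces an isomorphism $H^r(\mathcal{D}_\mathcal{F})\cong H^r_b(M,\mathcal{F})$ for every $r\ge 0$. -/

import Mathlib

open scoped Manifold ContDiff Topology
open TopologicalSpace

noncomputable section

namespace FoliationCohomology

/-- Euclidean space of dimension `n`. -/
abbrev Euc (n : ℕ) : Type := EuclideanSpace ℝ (Fin n)

section Forms

variable {k n r : ℕ}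
  {N : Type*} [TopologicalSpace N] [ChartedSpace (Euc n) N]
  {N' : Type*} [TopologicalSpace N'] [ChartedSpace (Euc k) N']

/-- Fields of alternating `r`-linear forms on the tangent spaces of `N`, with no regularity. -/
abbrev AltField (n : ℕ) (N : Type*) [TopologicalSpace N] [ChartedSpace (Euc n) N] (r : ℕ) :=
  (x : N) → TangentSpace (𝓡 n) x [⋀^Fin r]→L[ℝ] ℝ

/-- The pull-back `f^* η`. -/
def pullback (f : N' → N) (η : AltField n N r) : AltField k N' r :=
  fun x ↦ (η (f x)).compContinuousLinearMap (mfderiv (𝓡 k) (𝓡 n) f x)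

/-- The expression of `η` in the coordinates of the preferred chart at `x₀`, that is, the pull-back
of `η` under the inverse of the chart; it is meaningful on the target of the chart. -/
def coord (η : AltField n N r) (x₀ : N) : Euc n → Euc n [⋀^Fin r]→L[ℝ] ℝ :=
  pullback (extChartAt (𝓡 n) x₀).symm η

/-- The exterior derivative, computed at `x` in the preferred chart at `x`; on smooth forms every
other chart gives the same result, see `coord_extD`. -/
def extD (η : AltField n N r) : AltField n N (r + 1) :=
  fun x ↦ (extDeriv (coord η x) (extChartAt (𝓡 n) x x)).compContinuousLinearMap
    (mfderiv (𝓡 n) (𝓡 n) (extChartAt (𝓡 n) x) x)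

/-- Smoothness of a differential form: all its coordinate expressions are smooth. -/
def IsSmoothForm (η : AltField n N r) : Prop :=
  ∀ x₀ : N, ContDiffOn ℝ ∞ (coord η x₀) (extChartAt (𝓡 n) x₀).target

theorem minSmoothness_two_le : minSmoothness ℝ 2 ≤ (∞ : WithTop ℕ∞) := by
  rw [minSmoothness_of_isRCLikeNormedField]
  exact ENat.LEInfty.out

theorem pullback_eventuallyEq [IsManifold (𝓡 n) ∞ N] {η : AltField n N r}
    {s : Set (Euc k)} (hs : IsOpen s) {g : Euc k → N} (hg : ContMDiffOn (𝓡 k) (𝓡 n) ∞ g s)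
    {z : Euc k} (hz : z ∈ s) :
    (pullback g η : Euc k → Euc k [⋀^Fin r]→L[ℝ] ℝ) =ᶠ[𝓝 z]
      fun y ↦ (coord η (g z) (extChartAt (𝓡 n) (g z) (g y))).compContinuousLinearMap
        (fderiv ℝ (fun y ↦ extChartAt (𝓡 n) (g z) (g y)) y) := by
  have hcont : ContinuousAt g z := (hg.contMDiffAt (hs.mem_nhds hz)).continuousAt
  filter_upwards [hs.mem_nhds hz, hcont (extChartAt_source_mem_nhds (I := 𝓡 n) (g z))] with y hy hgy
  have hgy' : g y ∈ (extChartAt (𝓡 n) (g z)).source := hgy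
  have hgy'' : g y ∈ (chartAt (Euc n) (g z)).source := by rwa [extChartAt_source] at hgy'
  have hgd : MDifferentiableAt (𝓡 k) (𝓡 n) g y :=
    (hg.contMDiffAt (hs.mem_nhds hy)).mdifferentiableAt (by simp)
  have hed : MDifferentiableAt (𝓡 n) (𝓡 n) (extChartAt (𝓡 n) (g z)) (g y) :=
    mdifferentiableAt_extChartAt hgy''
  have h1 : fderiv ℝ (fun y ↦ extChartAt (𝓡 n) (g z) (g y)) y =
      (mfderiv (𝓡 n) (𝓡 n) (extChartAt (𝓡 n) (g z)) (g y)).comp (mfderiv (𝓡 k) (𝓡 n) g y) := by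
    rw [← mfderiv_eq_fderiv]
    exact mfderiv_comp y hed hgd
  have h2 := mfderivWithin_extChartAt_symm_comp_mfderiv_extChartAt' (I := 𝓡 n) hgy'
  rw [ModelWithCorners.range_eq_univ, mfderivWithin_univ] at h2
  have key : ∀ (p : N) (w : Fin r → Euc n), p = g y →
      (η p : Euc n [⋀^Fin r]→L[ℝ] ℝ) w = (η (g y) : Euc n [⋀^Fin r]→L[ℝ] ℝ) w := by
    rintro p w rfl
    rfl
  ext v
  rw [h1]
  refine Eq.symm ((key _ _ ((extChartAt (𝓡 n) (g z)).left_inv hgy')).trans ?_)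
  refine congrArg (η (g y) : Euc n [⋀^Fin r]→L[ℝ] ℝ) (funext fun i ↦ ?_)
  exact DFunLike.congr_fun h2 (mfderiv (𝓡 k) (𝓡 n) g y (v i))

theorem extDeriv_pullback_eq [IsManifold (𝓡 n) ∞ N] {η : AltField n N r} (hη : IsSmoothForm η)
    {s : Set (Euc k)} (hs : IsOpen s) {g : Euc k → N} (hg : ContMDiffOn (𝓡 k) (𝓡 n) ∞ g s)
    {z : Euc k} (hz : z ∈ s) :
    extDeriv (pullback g η : Euc k → Euc k [⋀^Fin r]→L[ℝ] ℝ) z = pullback g (extD η) z := by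
  rw [(pullback_eventuallyEq hs hg hz).extDeriv_eq]
  have hgz : MDifferentiableAt (𝓡 k) (𝓡 n) g z :=
    (hg.contMDiffAt (hs.mem_nhds hz)).mdifferentiableAt (by simp)
  have he : MDifferentiableAt (𝓡 n) (𝓡 n) (extChartAt (𝓡 n) (g z)) (g z) :=
    mdifferentiableAt_extChartAt (mem_chart_source _ _)
  have hc : ContDiffAt ℝ ∞ (fun y ↦ extChartAt (𝓡 n) (g z) (g y)) z :=
    ContMDiffAt.contDiffAt
      ((contMDiffAt_extChartAt (I := 𝓡 n) (x := g z)).comp z (hg.contMDiffAt (hs.mem_nhds hz)))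
  have hd : DifferentiableAt ℝ (coord η (g z)) (extChartAt (𝓡 n) (g z) (g z)) :=
    ((hη (g z)).contDiffAt (extChartAt_target_mem_nhds (I := 𝓡 n) (g z))).differentiableAt
      (by simp)
  rw [extDeriv_pullback (f := fun y ↦ extChartAt (𝓡 n) (g z) (g y)) hd hc (r := ∞) minSmoothness_two_le]
  have h1 : fderiv ℝ (fun y ↦ extChartAt (𝓡 n) (g z) (g y)) z =
      (mfderiv (𝓡 n) (𝓡 n) (extChartAt (𝓡 n) (g z)) (g z)).comp (mfderiv (𝓡 k) (𝓡 n) g z) := by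
    rw [← mfderiv_eq_fderiv]
    exact mfderiv_comp z he hgz
  rw [h1]
  rfl

/-- The coordinate expression of the exterior derivative in any preferred chart is the exterior
derivative of the coordinate expression. -/
theorem coord_extD [IsManifold (𝓡 n) ∞ N] {η : AltField n N r} (hη : IsSmoothForm η) (x₀ : N)
    {z : Euc n} (hz : z ∈ (extChartAt (𝓡 n) x₀).target) :
    coord (extD η) x₀ z = extDeriv (coord η x₀) z :=
  (extDeriv_pullback_eq hη (isOpen_extChartAt_target x₀) (contMDiffOn_extChartAt_symm x₀) hz).symm

theorem isSmoothForm_extD [IsManifold (𝓡 n) ∞ N] {η : AltField n N r} (hη : IsSmoothForm η) :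
    IsSmoothForm (extD η) := by
  intro x₀
  refine ContDiffOn.congr ?_ fun z hz ↦ coord_extD hη x₀ hz
  have h := (hη x₀).fderiv_of_isOpen (m := ∞) (isOpen_extChartAt_target x₀) (by simp)
  exact (ContinuousAlternatingMap.alternatizeUncurryFinCLM ℝ (Euc n) ℝ).contDiff.comp_contDiffOn h

theorem extD_extD [IsManifold (𝓡 n) ∞ N] {η : AltField n N r} (hη : IsSmoothForm η) :
    extD (extD η) = 0 := by
  funext x
  have hx := extChartAt_target_mem_nhds (I := 𝓡 n) x
  have h1 : coord (extD η) x =ᶠ[𝓝 (extChartAt (𝓡 n) x x)]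
      extDeriv (coord η x) := by
    filter_upwards [hx] with z hz using coord_extD hη x hz
  show ContinuousAlternatingMap.compContinuousLinearMap _ _ = _
  rw [h1.extDeriv_eq, extDeriv_extDeriv_apply (r := ∞) ((hη x).contDiffAt hx) minSmoothness_two_le]
  rfl

theorem coord_pullback [IsManifold (𝓡 n) ∞ N] [IsManifold (𝓡 k) ∞ N'] (η : AltField n N r)
    {f : N' → N} (hf : ContMDiff (𝓡 k) (𝓡 n) ∞ f) (x₀ : N') {z : Euc k}
    (hz : z ∈ (extChartAt (𝓡 k) x₀).target) :
    coord (pullback f η) x₀ z = pullback (f ∘ (extChartAt (𝓡 k) x₀).symm) η z := by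
  have h1 : MDifferentiableAt (𝓡 k) (𝓡 k) (extChartAt (𝓡 k) x₀).symm z :=
    ((contMDiffOn_extChartAt_symm (n := ∞) x₀).contMDiffAt
      ((isOpen_extChartAt_target x₀).mem_nhds hz)).mdifferentiableAt (by simp)
  have h2 : MDifferentiableAt (𝓡 k) (𝓡 n) f ((extChartAt (𝓡 k) x₀).symm z) :=
    (hf _).mdifferentiableAt (by simp)
  show _ = ContinuousAlternatingMap.compContinuousLinearMap _ _
  rw [mfderiv_comp z h2 h1]
  rfl

/-- The exterior derivative commutes with pull-backs under smooth maps. -/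
theorem extD_pullback [IsManifold (𝓡 n) ∞ N] [IsManifold (𝓡 k) ∞ N'] {η : AltField n N r}
    (hη : IsSmoothForm η) {f : N' → N} (hf : ContMDiff (𝓡 k) (𝓡 n) ∞ f) :
    extD (n := k) (pullback f η) = pullback f (extD η) := by
  funext x
  have hx := extChartAt_target_mem_nhds (I := 𝓡 k) x
  have hx' := mem_extChartAt_target (I := 𝓡 k) x
  have h1 : coord (pullback f η) x =ᶠ[𝓝 (extChartAt (𝓡 k) x x)]
      pullback (f ∘ (extChartAt (𝓡 k) x).symm) η := by
    filter_upwards [hx] with z hz using coord_pullback η hf x hz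
  have h2 := hf.comp_contMDiffOn (contMDiffOn_extChartAt_symm (I := 𝓡 k) (n := ∞) x)
  have h3 : extDeriv (coord (pullback f η) x) (extChartAt (𝓡 k) x x) =
      coord (pullback f (extD η)) x (extChartAt (𝓡 k) x x) := by
    rw [h1.extDeriv_eq, extDeriv_pullback_eq hη (isOpen_extChartAt_target x) h2 hx',
      coord_pullback _ hf x hx']
  have h4 := mfderivWithin_extChartAt_symm_comp_mfderiv_extChartAt' (I := 𝓡 k)
    (mem_extChartAt_source (I := 𝓡 k) x)
  rw [ModelWithCorners.range_eq_univ, mfderivWithin_univ] at h4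
  have key : ∀ (p : N') (w : Fin (r + 1) → Euc k), p = x →
      (pullback f (extD η) p : Euc k [⋀^Fin (r + 1)]→L[ℝ] ℝ) w =
        (pullback f (extD η) x : Euc k [⋀^Fin (r + 1)]→L[ℝ] ℝ) w := by
    rintro p w rfl
    rfl
  show ContinuousAlternatingMap.compContinuousLinearMap _ _ = _
  rw [h3]
  ext v
  refine (key _ _ ((extChartAt (𝓡 k) x).left_inv (mem_extChartAt_source (I := 𝓡 k) x))).trans ?_
  refine congrArg (pullback f (extD η) x : Euc k [⋀^Fin (r + 1)]→L[ℝ] ℝ) (funext fun i ↦ ?_)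
  exact DFunLike.congr_fun h4 (v i)


theorem coord_add (η₁ η₂ : AltField n N r) (x₀ : N) :
    coord (η₁ + η₂) x₀ = coord η₁ x₀ + coord η₂ x₀ := rfl

theorem coord_smul (c : ℝ) (η : AltField n N r) (x₀ : N) :
    coord (c • η) x₀ = c • coord η x₀ := rfl

/-- Smooth forms of degree `r` as a subspace of all fields of alternating forms. -/
def smoothForms (n : ℕ) (N : Type*) [TopologicalSpace N] [ChartedSpace (Euc n) N] (r : ℕ) :
    Submodule ℝ (AltField n N r) where
  carrier := {η | IsSmoothForm η}
  zero_mem' := fun _ ↦ contDiffOn_const (c := 0)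
  add_mem' := fun h₁ h₂ x₀ ↦ (h₁ x₀).add (h₂ x₀)
  smul_mem' := fun c _ h x₀ ↦ (h x₀).const_smul c

/-- The real vector space `Ω^r(N)` of smooth differential forms of degree `r` on the manifold `N`. -/
def Form (n : ℕ) (N : Type*) [TopologicalSpace N] [ChartedSpace (Euc n) N] (r : ℕ) : Type _ :=
  smoothForms n N r

instance instAddCommGroupForm : AddCommGroup (Form n N r) := inferInstanceAs (AddCommGroup (smoothForms n N r))

instance instModuleForm : Module ℝ (Form n N r) := inferInstanceAs (Module ℝ (smoothForms n N r))

/-- The exterior differential `d : Ω^r(N) → Ω^(r+1)(N)`. -/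
def d [IsManifold (𝓡 n) ∞ N] : Form n N r →ₗ[ℝ] Form n N (r + 1) where
  toFun η := ⟨extD η.1, isSmoothForm_extD η.2⟩
  map_add' η₁ η₂ := by
    refine Subtype.ext (funext fun x ↦ ?_)
    have hx := extChartAt_target_mem_nhds (I := 𝓡 n) x
    have h₁ := ((η₁.2 x).contDiffAt hx).differentiableAt (by simp)
    have h₂ := ((η₂.2 x).contDiffAt hx).differentiableAt (by simp)
    show ContinuousAlternatingMap.compContinuousLinearMap (extDeriv (coord (η₁.1 + η₂.1) x) _) _ = _
    rw [coord_add, extDeriv_add h₁ h₂]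
    rfl
  map_smul' c η := by
    refine Subtype.ext (funext fun x ↦ ?_)
    show ContinuousAlternatingMap.compContinuousLinearMap (extDeriv (coord (c • η.1) x) _) _ = _
    rw [coord_smul, extDeriv_smul]
    rfl

theorem d_d [IsManifold (𝓡 n) ∞ N] (η : Form n N r) : d (d η) = 0 :=
  Subtype.ext (extD_extD η.2)

/-- `i_X η = 0`: the form `η` vanishes as soon as one of its arguments is `X`. For `r = 0` there is
no condition. -/
def InteriorVanishes (X : (x : N) → TangentSpace (𝓡 n) x) (η : AltField n N r) : Prop :=
  ∀ (x : N) (v : Fin r → TangentSpace (𝓡 n) x) (i : Fin r), v i = X x → η x v = 0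

theorem InteriorVanishes.add {X : (x : N) → TangentSpace (𝓡 n) x} {η₁ η₂ : AltField n N r}
    (h₁ : InteriorVanishes X η₁) (h₂ : InteriorVanishes X η₂) : InteriorVanishes X (η₁ + η₂) := by
  intro x v i hv
  show η₁ x v + η₂ x v = 0
  rw [h₁ x v i hv, h₂ x v i hv, add_zero]

theorem InteriorVanishes.smul {X : (x : N) → TangentSpace (𝓡 n) x} {η : AltField n N r}
    (h : InteriorVanishes X η) (c : ℝ) : InteriorVanishes X (c • η) := by
  intro x v i hv
  show c • η x v = 0
  rw [h x v i hv, smul_zero]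

end Forms

section Diffeologies

universe u

/-- A diffeology of class `C^∞` on a set `X`: a family of plots, that is, of maps `U → X` defined on
open subsets `U` of Euclidean spaces, which contains the constant plots, is stable under composition
with smooth maps `V → U` between open subsets of Euclidean spaces, and is local. -/
structure Diffeology (X : Type u) where
  IsPlot : ∀ {n : ℕ} (U : Opens (Euc n)), (U → X) → Prop
  const_mem : ∀ {n : ℕ} (U : Opens (Euc n)) (x : X), IsPlot U fun _ ↦ x
  comp_mem : ∀ {n k : ℕ} {U : Opens (Euc n)} {α : U → X}, IsPlot U α →
    ∀ (V : Opens (Euc k)) (h : V → U), ContMDiff (𝓡 k) (𝓡 n) ∞ h → IsPlot V (α ∘ h)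
  local_mem : ∀ {n : ℕ} {U : Opens (Euc n)} {α : U → X},
    (∀ t : U, ∃ (V : Opens (Euc n)) (hV : V ≤ U), t.1 ∈ V ∧ IsPlot V (α ∘ Opens.inclusion hV)) →
      IsPlot U α

namespace Diffeology

variable {X : Type u} (D : Diffeology X)

/-- The plots of the diffeology with domain `U`. -/
abbrev Plots {n : ℕ} (U : Opens (Euc n)) : Type u :=
  {α : U → X // D.IsPlot U α}

/-- The space `Ω^r(D)` of differential forms of degree `r` of a diffeology `D`: families of forms
`θ_α` on `U`, indexed by the plots `α : U → X` of `D`, such that `θ_(α ∘ h) = h^* θ_α` for all smooth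
maps `h : V → U`. -/
def forms (r : ℕ) :
    Submodule ℝ ((n : ℕ) → (U : Opens (Euc n)) → D.Plots U → Form n U r) where
  carrier := {θ | ∀ {n k : ℕ} {U : Opens (Euc n)} {V : Opens (Euc k)} (α : D.Plots U) (h : V → U)
    (hh : ContMDiff (𝓡 k) (𝓡 n) ∞ h),
    (θ k V ⟨α.1 ∘ h, D.comp_mem α.2 V h hh⟩).1 = pullback h (θ n U α).1}
  zero_mem' := fun _ _ _ ↦ rfl
  add_mem' := by
    intro θ₁ θ₂ h₁ h₂ n k U V α h hh
    show (θ₁ k V _).1 + (θ₂ k V _).1 = _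
    rw [h₁ α h hh, h₂ α h hh]
    rfl
  smul_mem' := by
    intro c θ h₁ n k U V α h hh
    show c • (θ k V _).1 = _
    rw [h₁ α h hh]
    rfl

/-- The exterior differential `{θ_α} ↦ {d θ_α}`. -/
def d {r : ℕ} : D.forms r →ₗ[ℝ] D.forms (r + 1) where
  toFun θ := ⟨fun n U α ↦ FoliationCohomology.d (θ.1 n U α), by
    intro n k U V α h hh
    show extD (n := k) (θ.1 k V ⟨α.1 ∘ h, _⟩).1 = pullback h (extD (θ.1 n U α).1)
    rw [θ.2 α h hh, extD_pullback (θ.1 n U α).2 hh]⟩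
  map_add' θ₁ θ₂ := Subtype.ext <| funext fun n ↦ funext fun U ↦ funext fun α ↦
    map_add FoliationCohomology.d (θ₁.1 n U α) (θ₂.1 n U α)
  map_smul' c θ := Subtype.ext <| funext fun n ↦ funext fun U ↦ funext fun α ↦
    map_smul FoliationCohomology.d c (θ.1 n U α)

theorem d_d {r : ℕ} (θ : D.forms r) : D.d (D.d θ) = 0 :=
  Subtype.ext <| funext fun n ↦ funext fun U ↦ funext fun α ↦
    FoliationCohomology.d_d (θ.1 n U α)

/-- The complex `(Ω(D), d)`. -/
def deRhamComplex : CochainComplex (ModuleCat.{u} ℝ) ℕ :=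
  CochainComplex.of (fun r ↦ ModuleCat.of ℝ (D.forms r)) (fun _ ↦ ModuleCat.ofHom D.d)
    fun _ ↦ ModuleCat.hom_ext (LinearMap.ext fun θ ↦ D.d_d θ)

/-- The De Rham cohomology `H^r(D)` of a diffeology. -/
def deRhamCohomology (r : ℕ) : ModuleCat.{u} ℝ :=
  D.deRhamComplex.homology r

end Diffeology

end Diffeologies

section Foliations

universe u

/-- A chart `φ : V → U × W ⊆ ℝ^p × ℝ^q` is adapted to a field `T` of tangent subspaces when it is a
diffeomorphism from the open set `V` of `M` onto the product `U × W` of two open convex sets and when,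
at each point of `V`, the subspace `T` is the kernel of the differential of the projection
`p₂ ∘ φ : V → W`, so that the fibres of `p₂ ∘ φ` are integral manifolds (the plaques). -/
structure IsAdaptedChart {p q m : ℕ} {M : Type u} [TopologicalSpace M] [ChartedSpace (Euc m) M]
    (T : (x : M) → Submodule ℝ (TangentSpace (𝓡 m) x))
    (φ : OpenPartialHomeomorph M (Euc p × Euc q)) : Prop where
  contMDiffOn : ContMDiffOn (𝓡 m) 𝓘(ℝ, Euc p × Euc q) ∞ φ φ.source
  contMDiffOn_symm : ContMDiffOn 𝓘(ℝ, Euc p × Euc q) (𝓡 m) ∞ φ.symm φ.target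
  target_eq_prod : ∃ (U : Set (Euc p)) (W : Set (Euc q)),
    IsOpen U ∧ IsOpen W ∧ Convex ℝ U ∧ Convex ℝ W ∧ φ.target = U ×ˢ W
  mem_iff : ∀ y ∈ φ.source, ∀ v : TangentSpace (𝓡 m) y,
    v ∈ T y ↔ mfderiv (𝓡 m) (𝓡 q) (fun z ↦ (φ z).2) y v = 0

/-- A smooth foliation of dimension `p` and codimension `q` on `M`, given by its tangent distribution
`T_x F`, which is completely integrable: there is an adapted chart around every point. -/
structure Foliation (p q m : ℕ) (M : Type u) [TopologicalSpace M] [ChartedSpace (Euc m) M] where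
  tangent : (x : M) → Submodule ℝ (TangentSpace (𝓡 m) x)
  exists_adapted : ∀ x : M, ∃ φ : OpenPartialHomeomorph M (Euc p × Euc q),
    x ∈ φ.source ∧ IsAdaptedChart tangent φ

namespace Foliation

variable {p q m : ℕ} {M : Type u} [TopologicalSpace M] [ChartedSpace (Euc m) M]
  (F : Foliation p q m M)

/-- A tangential path: a smooth path `[0, 1] → M` whose velocity is everywhere tangent to the
foliation. Values of `μ` outside of `[0, 1]` are irrelevant. -/
structure IsTangentialPath (μ : ℝ → M) : Prop where
  contMDiffOn : ContMDiffOn 𝓘(ℝ, ℝ) (𝓡 m) ∞ μ (Set.Icc 0 1)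
  velocity_mem : ∀ t ∈ Set.Icc (0 : ℝ) 1,
    mfderivWithin 𝓘(ℝ, ℝ) (𝓡 m) μ (Set.Icc 0 1) t (1 : ℝ) ∈ F.tangent (μ t)

/-- Two points are on the same leaf iff they can be joined by finitely many consecutive tangential
paths. -/
def leafSetoid : Setoid M :=
  Relation.EqvGen.setoid fun x y ↦ ∃ μ : ℝ → M, F.IsTangentialPath μ ∧ μ 0 = x ∧ μ 1 = y

/-- The space of leaves `M/F`. -/
def LeafSpace : Type u := Quotient F.leafSetoid

/-- The canonical projection `π : M → M/F`. -/
def proj (x : M) : F.LeafSpace := Quotient.mk F.leafSetoid x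

/-- The quotient diffeology of the space of leaves: its plots are the maps `U → M/F` that locally lift
to smooth maps `V → M` through `π`. -/
def quotientDiffeology : Diffeology F.LeafSpace where
  IsPlot {n} U α := ∀ t : U, ∃ (V : Opens (Euc n)) (hV : V ≤ U), t.1 ∈ V ∧
    ∃ β : V → M, ContMDiff (𝓡 n) (𝓡 m) ∞ β ∧ α ∘ Opens.inclusion hV = F.proj ∘ β
  const_mem U x t := by
    obtain ⟨y, rfl⟩ := Quotient.exists_rep x
    exact ⟨U, le_rfl, t.2, fun _ ↦ y, contMDiff_const, rfl⟩
  comp_mem {n k U α} hα V h hh t := by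
    obtain ⟨W, hW, htW, β, hβ, hαβ⟩ := hα (h t)
    let S : Opens V := ⟨{v | (h v).1 ∈ W},
      W.isOpen.preimage (continuous_subtype_val.comp hh.continuous)⟩
    let V' : Opens (Euc k) := ⟨Subtype.val '' (S : Set V), V.isOpen.isOpenMap_subtype_val _ S.isOpen⟩
    have hV' : V' ≤ V := by
      rintro _ ⟨v, -, rfl⟩
      exact v.2
    have hm : ∀ v : V', (h (Opens.inclusion hV' v)).1 ∈ W := by
      rintro ⟨_, v, hv, rfl⟩
      exact hv
    refine ⟨V', hV', ⟨t, htW, rfl⟩, β ∘ fun v ↦ ⟨_, hm v⟩, hβ.comp ?_, ?_⟩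
    · refine (ContMDiff.subtypeVal_comp_iff W _).1 ?_
      have h₁ : ContMDiff (𝓡 k) (𝓡 n) ∞ (Subtype.val ∘ h ∘ Opens.inclusion hV') :=
        contMDiff_subtype_val.comp (hh.comp (contMDiff_inclusion hV'))
      exact h₁
    · funext v
      exact congrFun hαβ ⟨_, hm v⟩
  local_mem {n U α} hα t := by
    obtain ⟨V, hV, htV, hα'⟩ := hα t
    obtain ⟨W, hW, htW, β, hβ, hαβ⟩ := hα' ⟨t, htV⟩
    exact ⟨W, hW.trans hV, htW, β, hβ, hαβ⟩

theorem isPlot_proj_comp {n : ℕ} {U : Opens (Euc n)} {β : U → M}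
    (hβ : ContMDiff (𝓡 n) (𝓡 m) ∞ β) : F.quotientDiffeology.IsPlot U (F.proj ∘ β) :=
  fun t ↦ ⟨U, le_rfl, t.2, β, hβ, rfl⟩

/-- Smooth vector fields on `M` that are tangent to the foliation. -/
structure IsTangentField [IsManifold (𝓡 m) ∞ M] (X : (x : M) → TangentSpace (𝓡 m) x) : Prop where
  contMDiff : ContMDiff (𝓡 m) (𝓡 m).tangent ∞ fun x ↦ (⟨x, X x⟩ : TangentBundle (𝓡 m) M)
  mem_tangent : ∀ x, X x ∈ F.tangent x

/-- The space `Ω_b^r(M, F)` of basic forms: `i_X η = 0` and `i_X dη = 0` for any vector field `X`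
tangent to the foliation. -/
def basicForms [IsManifold (𝓡 m) ∞ M] (r : ℕ) : Submodule ℝ (Form m M r) where
  carrier := {η | ∀ X, F.IsTangentField X →
    InteriorVanishes X η.1 ∧ InteriorVanishes X (FoliationCohomology.d η).1}
  zero_mem' := fun X _ ↦ ⟨fun _ _ _ _ ↦ rfl, by rw [map_zero]; exact fun _ _ _ _ ↦ rfl⟩
  add_mem' := by
    intro η₁ η₂ h₁ h₂ X hX
    exact ⟨(h₁ X hX).1.add (h₂ X hX).1, by rw [map_add]; exact (h₁ X hX).2.add (h₂ X hX).2⟩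
  smul_mem' := by
    intro c η h X hX
    exact ⟨(h X hX).1.smul c, by rw [map_smul]; exact (h X hX).2.smul c⟩

/-- The exterior differential restricted to basic forms. -/
def basicD [IsManifold (𝓡 m) ∞ M] {r : ℕ} : F.basicForms r →ₗ[ℝ] F.basicForms (r + 1) :=
  (FoliationCohomology.d.comp (F.basicForms r).subtype).codRestrict _ fun η X hX ↦
    ⟨(η.2 X hX).2, by
      show InteriorVanishes X (FoliationCohomology.d (FoliationCohomology.d η.1)).1
      rw [FoliationCohomology.d_d]
      exact fun _ _ _ _ ↦ rfl⟩

/-- The complex `Ω_b(M, F)` of basic forms. -/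
def basicComplex [IsManifold (𝓡 m) ∞ M] : CochainComplex (ModuleCat.{u} ℝ) ℕ :=
  CochainComplex.of (fun r ↦ ModuleCat.of ℝ (F.basicForms r)) (fun _ ↦ ModuleCat.ofHom F.basicD)
    fun _ ↦ ModuleCat.hom_ext (LinearMap.ext fun η ↦ Subtype.ext (FoliationCohomology.d_d η.1))

/-- The basic cohomology `H_b^r(M, F)`. -/
def basicCohomology [IsManifold (𝓡 m) ∞ M] (r : ℕ) : ModuleCat.{u} ℝ :=
  F.basicComplex.homology r

/-- `Q`-foliations: the `C^∞` tubular property. The parameter manifold `X` ranges over `Type`, which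
is no restriction: the property is local around the base point `x`, and every point of a manifold of
dimension `n` has a neighbourhood diffeomorphic to `ℝ^n`. -/
def IsQFoliation : Prop :=
  ∀ (n : ℕ) (X : Type) [TopologicalSpace X] [ChartedSpace (Euc n) X] [IsManifold (𝓡 n) ∞ X]
    [T2Space X] [SecondCountableTopology X] (x : X) (β γ : X → M),
    ContMDiff (𝓡 n) (𝓡 m) ∞ β → ContMDiff (𝓡 n) (𝓡 m) ∞ γ → F.proj ∘ β = F.proj ∘ γ →
    ∀ μ : ℝ → M, F.IsTangentialPath μ → μ 0 = β x → μ 1 = γ x →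
    ∃ (U : Set X) (H : X → ℝ → M), IsOpen U ∧ x ∈ U ∧
      ContMDiffOn ((𝓡 n).prod 𝓘(ℝ, ℝ)) (𝓡 m) ∞ (fun z : X × ℝ ↦ H z.1 z.2) (U ×ˢ Set.Icc 0 1) ∧
      (∀ y ∈ U, H y 0 = β y ∧ H y 1 = γ y) ∧
      (∀ t ∈ Set.Icc (0 : ℝ) 1, H x t = μ t) ∧
      ∀ y ∈ U, F.IsTangentialPath (H y)

end Foliation

end Foliations

end FoliationCohomology

end

open FoliationCohomology

/-!
Write `π : M → M/F` for the projection and `D` for the quotient diffeology.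

**The map `B`.** A form `θ` of `D` has a component `θ_(π ∘ β)` for each smooth `β : U → M`, in
particular for inverses of charts. The compatibility `θ_(α ∘ h) = h^* θ_α`, applied to coordinate
expressions of maps, shows that these local forms glue to a form `Bθ` on `M` with
`β^*(Bθ) = θ_(π ∘ β)` for all `β` (`Foliation.pullback_descent`). A form on `M` is determined by its
pull-backs `β^*` (`ext_of_pullback_eq`), so `B` is linear and commutes with `d`.

`Bθ` is basic: in an adapted chart there is a local retraction `s` onto the transversal through a
given point, along the plaques. It satisfies `π ∘ s = π`, hence `s^*(Bθ) = Bθ`, and its differential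
kills the vectors tangent to the foliation (`Foliation.exists_retraction`). So `Bθ` vanishes as soon as
one argument is tangent, and so does `d(Bθ) = B(dθ)`.

**Injectivity.** The plots of `D` locally are of the form `π ∘ β`, with component `β^*(Bθ)`.

**Surjectivity.** Given a basic form `ω`, let the component at a plot `α` be `β^* ω` for local lifts
`β` of `α`. This does not depend on the lift: if `π ∘ β = π ∘ γ`, then `β(x)` and `γ(x)` are joined by
a single tangential path (`Foliation.exists_isTangentialPath_of_proj_eq`), and the tubular property
yields a homotopy `H` from `β` to `γ` along tangential paths. Since `i_X ω = 0` and `i_X dω = 0` for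
tangent `X`, the contractions of `H^* ω` and of `d(H^* ω)` with `∂/∂t` vanish, and by Cartan's formula
the pull-back of `ω` under `H(·, t)` does not depend on `t` (`Foliation.pullback_eq_of_tangential`,
`Foliation.IsQFoliation.pullback_eq`). Here basic forms, which are tested on global vector fields,
vanish on every single tangent vector because such a vector extends to a global tangent field
(`Foliation.exists_isTangentField`).

A morphism of complexes that is bijective in each degree is an isomorphism, so it induces
isomorphisms in cohomology.
-/

noncomputable section

namespace FoliationCohomology

section

variable {k n r : ℕ}
  {N : Type*} [TopologicalSpace N] [ChartedSpace (Euc n) N]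
  {N' : Type*} [TopologicalSpace N'] [ChartedSpace (Euc k) N']

/-! ### Pull-backs -/

/-- On finite-dimensional spaces, smoothness of a family of alternating maps can be tested on the
underlying multilinear maps, since the inclusion of the former into the latter splits. -/
theorem contDiffAt_of_toContinuousMultilinearMap {X E : Type*} [NormedAddCommGroup X]
    [NormedSpace ℝ X] [NormedAddCommGroup E] [NormedSpace ℝ E] [FiniteDimensional ℝ E]
    {f : X → E [⋀^Fin r]→L[ℝ] ℝ} {x : X}
    (hf : ContDiffAt ℝ ∞ (fun y ↦ (f y).toContinuousMultilinearMap) x) : ContDiffAt ℝ ∞ f x := by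
  let ι : (E [⋀^Fin r]→L[ℝ] ℝ) →ₗ[ℝ] ContinuousMultilinearMap ℝ (fun _ : Fin r ↦ E) ℝ :=
    ContinuousAlternatingMap.toContinuousMultilinearMapLinear
  have hι : LinearMap.ker ι = ⊥ :=
    LinearMap.ker_eq_bot.2 ContinuousAlternatingMap.toContinuousMultilinearMap_injective
  have hfin : FiniteDimensional ℝ (ContinuousMultilinearMap ℝ (fun _ : Fin r ↦ E) ℝ) :=
    FiniteDimensional.of_injective
      (ContinuousMultilinearMap.toMultilinearMapLinear :
        ContinuousMultilinearMap ℝ (fun _ : Fin r ↦ E) ℝ →ₗ[ℝ] _)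
      ContinuousMultilinearMap.toMultilinearMap_injective
  obtain ⟨L, hL⟩ := ι.exists_leftInverse_of_injective hι
  have h1 := (LinearMap.toContinuousLinearMap L).contDiff.contDiffAt.comp x hf
  exact h1.congr_of_eventuallyEq
    (Filter.Eventually.of_forall fun y ↦ (LinearMap.congr_fun hL (f y)).symm)

theorem contDiffAt_compContinuousLinearMap {X E E' : Type*} [NormedAddCommGroup X]
    [NormedSpace ℝ X] [NormedAddCommGroup E] [NormedSpace ℝ E] [FiniteDimensional ℝ E]
    [NormedAddCommGroup E'] [NormedSpace ℝ E']
    {f : X → E' [⋀^Fin r]→L[ℝ] ℝ} {A : X → E →L[ℝ] E'} {x : X}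
    (hf : ContDiffAt ℝ ∞ f x) (hA : ContDiffAt ℝ ∞ A x) :
    ContDiffAt ℝ ∞ (fun y ↦ (f y).compContinuousLinearMap (A y)) x := by
  refine contDiffAt_of_toContinuousMultilinearMap ?_
  have h1 : ContDiffAt ℝ ∞ (fun y ↦ (f y).toContinuousMultilinearMap) x :=
    (ContinuousAlternatingMap.toContinuousMultilinearMapCLM (𝕜 := ℝ) (E := E') (ι := Fin r)
      (F := ℝ) ℝ).contDiff.contDiffAt.comp x hf
  have h2 : ContDiffAt ℝ ∞ (fun y ↦
      ContinuousMultilinearMap.compContinuousLinearMapContinuousMultilinear ℝ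
        (fun _ : Fin r ↦ E) (fun _ : Fin r ↦ E') ℝ (fun _ ↦ A y)) x :=
    (ContinuousMultilinearMap.contDiff _).contDiffAt.comp x (contDiffAt_pi.2 fun _ ↦ hA)
  exact h2.clm_apply h1

theorem pullback_congr {f g : N' → N} {x : N'} (h : f =ᶠ[𝓝 x] g) (η : AltField n N r) :
    pullback (k := k) f η x = pullback (k := k) g η x := by
  have h1 : f x = g x := h.eq_of_nhds
  have h2 : (mfderiv (𝓡 k) (𝓡 n) f x : Euc k →L[ℝ] Euc n) = mfderiv (𝓡 k) (𝓡 n) g x := h.mfderiv_eq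
  have key : ∀ (p : N) (w : Fin r → Euc n), p = g x →
      (η p : Euc n [⋀^Fin r]→L[ℝ] ℝ) w = (η (g x) : Euc n [⋀^Fin r]→L[ℝ] ℝ) w := by
    rintro p w rfl
    rfl
  refine ContinuousAlternatingMap.ext fun v ↦ ?_
  refine (key (f x) _ h1).trans ?_
  exact congrArg (η (g x) : Euc n [⋀^Fin r]→L[ℝ] ℝ)
    (funext fun i ↦ DFunLike.congr_fun h2 (v i))

theorem pullback_comp {l : ℕ} {N'' : Type*} [TopologicalSpace N''] [ChartedSpace (Euc l) N'']
    {f : N' → N} {g : N'' → N'} {x : N''} (hf : MDifferentiableAt (𝓡 k) (𝓡 n) f (g x))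
    (hg : MDifferentiableAt (𝓡 l) (𝓡 k) g x) (η : AltField n N r) :
    pullback (k := l) (f ∘ g) η x = pullback (k := l) g (pullback (k := k) f η) x := by
  show ContinuousAlternatingMap.compContinuousLinearMap _ _ = _
  rw [mfderiv_comp x hf hg]
  rfl

theorem contDiffOn_pullback [IsManifold (𝓡 n) ∞ N] {η : AltField n N r} (hη : IsSmoothForm η)
    {s : Set (Euc k)} (hs : IsOpen s) {g : Euc k → N} (hg : ContMDiffOn (𝓡 k) (𝓡 n) ∞ g s) :
    ContDiffOn ℝ ∞ (F := Euc k [⋀^Fin r]→L[ℝ] ℝ) (pullback g η) s := by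
  intro z hz
  have hc : ContDiffAt ℝ ∞ (fun y ↦ extChartAt (𝓡 n) (g z) (g y)) z :=
    ContMDiffAt.contDiffAt
      ((contMDiffAt_extChartAt (I := 𝓡 n) (x := g z)).comp z (hg.contMDiffAt (hs.mem_nhds hz)))
  have hd : ContDiffAt ℝ ∞ (coord η (g z)) (extChartAt (𝓡 n) (g z) (g z)) :=
    (hη (g z)).contDiffAt (extChartAt_target_mem_nhds (I := 𝓡 n) (g z))
  refine ContDiffAt.contDiffWithinAt
    (ContDiffAt.congr_of_eventuallyEq ?_ (pullback_eventuallyEq hs hg hz))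
  have h1 : ContDiffAt ℝ ∞
      (fun y ↦ coord η (g z) (extChartAt (𝓡 n) (g z) (g y))) z := hd.comp z hc
  have h2 : ContDiffAt ℝ ∞
      (fun y ↦ fderiv ℝ (fun y ↦ extChartAt (𝓡 n) (g z) (g y)) y) z :=
    hc.fderiv_right (m := ∞) (by simp)
  exact contDiffAt_compContinuousLinearMap h1 h2

theorem IsSmoothForm.pullback [IsManifold (𝓡 n) ∞ N] [IsManifold (𝓡 k) ∞ N'] {η : AltField n N r}
    (hη : IsSmoothForm η) {f : N' → N} (hf : ContMDiff (𝓡 k) (𝓡 n) ∞ f) :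
    IsSmoothForm (n := k) (pullback f η) := by
  intro x₀
  refine ContDiffOn.congr ?_ fun z hz ↦ coord_pullback η hf x₀ hz
  exact contDiffOn_pullback hη (isOpen_extChartAt_target x₀)
    (hf.comp_contMDiffOn (contMDiffOn_extChartAt_symm (I := 𝓡 k) (n := ∞) x₀))

/-! ### Open subsets of Euclidean space -/

theorem hasMFDerivAt_subtype_val {U : Opens (Euc n)} (x : U) :
    HasMFDerivAt (𝓡 n) (𝓡 n) (Subtype.val : U → Euc n) x (ContinuousLinearMap.id ℝ (Euc n)) := by
  refine ⟨continuous_subtype_val.continuousAt, ?_⟩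
  refine (hasFDerivWithinAt_id _ _).congr_of_eventuallyEq ?_ ?_
  · refine Filter.Eventually.filter_mono nhdsWithin_le_nhds ?_
    filter_upwards [extChartAt_target_mem_nhds (I := 𝓡 n) x] with z hz
    exact (extChartAt (𝓡 n) x).right_inv hz
  · exact (extChartAt (𝓡 n) x).right_inv (mem_extChartAt_target (I := 𝓡 n) x)

theorem mfderiv_subtype_val {U : Opens (Euc n)} (x : U) :
    mfderiv (𝓡 n) (𝓡 n) (Subtype.val : U → Euc n) x = ContinuousLinearMap.id ℝ (Euc n) :=
  (hasMFDerivAt_subtype_val x).mfderiv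

theorem mfderiv_inclusion {U V : Opens (Euc n)} (h : U ≤ V) (x : U) :
    mfderiv (𝓡 n) (𝓡 n) (Opens.inclusion h) x = ContinuousLinearMap.id ℝ (Euc n) := by
  have h1 := mfderiv_comp x (hasMFDerivAt_subtype_val (Opens.inclusion h x)).mdifferentiableAt
    ((contMDiff_inclusion (n := ∞) h x).mdifferentiableAt (by simp))
  have h2 : (Subtype.val : V → Euc n) ∘ Opens.inclusion h = Subtype.val := rfl
  rw [h2, mfderiv_subtype_val, mfderiv_subtype_val] at h1
  exact h1.symm

/-- The tangent spaces of an open subset of `ℝ^n` all are `ℝ^n` itself, so that restriction to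
a smaller open set does not change the values of a form. -/
theorem pullback_inclusion {U V : Opens (Euc n)} (h : U ≤ V) (η : AltField n V r) (x : U) :
    (pullback (Opens.inclusion h) η x : Euc n [⋀^Fin r]→L[ℝ] ℝ) = η (Opens.inclusion h x) := by
  refine ContinuousAlternatingMap.ext fun v ↦ ?_
  refine congrArg (η (Opens.inclusion h x) : Euc n [⋀^Fin r]→L[ℝ] ℝ) (funext fun i ↦ ?_)
  exact DFunLike.congr_fun (mfderiv_inclusion h x) (v i)

theorem pullback_subtype_val {U : Opens (Euc n)} (η : AltField n (Euc n) r) (x : U) :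
    (pullback (Subtype.val : U → Euc n) η x : Euc n [⋀^Fin r]→L[ℝ] ℝ) = η x.1 := by
  refine ContinuousAlternatingMap.ext fun v ↦ ?_
  refine congrArg (η x.1 : Euc n [⋀^Fin r]→L[ℝ] ℝ) (funext fun i ↦ ?_)
  exact DFunLike.congr_fun (mfderiv_subtype_val x) (v i)

theorem extChartAt_opens_target {U : Opens (Euc n)} (x : U) :
    (extChartAt (𝓡 n) x).target = U := by
  ext z
  simp [extChartAt, Opens.chartAt_eq, OpenPartialHomeomorph.subtypeRestr, chartAt_self_eq]

/-- On an open subset of `ℝ^n`, smoothness in the sense of charts is smoothness as a function with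
values in the fixed space of alternating forms on `ℝ^n`. -/
theorem isSmoothForm_opens_iff {U : Opens (Euc n)} {η : AltField n U r}
    {η' : Euc n → Euc n [⋀^Fin r]→L[ℝ] ℝ} (h : ∀ x : U, η' x.1 = η x) :
    IsSmoothForm η ↔ ContDiffOn ℝ ∞ η' U := by
  have key : ∀ x₀ : U, Set.EqOn (coord η x₀) η' U := by
    intro x₀ z hz
    rw [← extChartAt_opens_target x₀] at hz
    have h1 : ((extChartAt (𝓡 n) x₀).symm z).1 = z := (extChartAt (𝓡 n) x₀).right_inv hz
    have hd : MDifferentiableAt (𝓡 n) (𝓡 n) (extChartAt (𝓡 n) x₀).symm z :=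
      ((contMDiffOn_extChartAt_symm (n := ∞) x₀).contMDiffAt
        ((isOpen_extChartAt_target x₀).mem_nhds hz)).mdifferentiableAt (by simp)
    have h2 := mfderiv_comp z
      (hasMFDerivAt_subtype_val ((extChartAt (𝓡 n) x₀).symm z)).mdifferentiableAt hd
    have h3 : (Subtype.val : U → Euc n) ∘ (extChartAt (𝓡 n) x₀).symm =ᶠ[𝓝 z] id := by
      filter_upwards [(isOpen_extChartAt_target x₀).mem_nhds hz] with y hy
      exact (extChartAt (𝓡 n) x₀).right_inv hy
    rw [h3.mfderiv_eq, mfderiv_subtype_val, mfderiv_id] at h2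
    rw [← h1, h, h1]
    refine ContinuousAlternatingMap.ext fun v ↦ ?_
    refine congrArg (η ((extChartAt (𝓡 n) x₀).symm z) : Euc n [⋀^Fin r]→L[ℝ] ℝ)
      (funext fun i ↦ ?_)
    exact (DFunLike.congr_fun h2 (v i)).symm
  constructor
  · intro hη z hz
    have := hη ⟨z, hz⟩
    rw [extChartAt_opens_target] at this
    exact (this z hz).congr (fun y hy ↦ (key ⟨z, hz⟩ hy).symm) (key ⟨z, hz⟩ hz).symm
  · intro hη x₀
    rw [extChartAt_opens_target]
    exact hη.congr (key x₀)

/-- Smoothness of a form on an open subset of Euclidean space is local. -/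
theorem isSmoothForm_opens_of_local {U : Opens (Euc n)} {η : AltField n U r}
    (h : ∀ t : U, ∃ (V : Opens (Euc n)) (hV : V ≤ U), t.1 ∈ V ∧
      IsSmoothForm (n := n) (pullback (k := n) (Opens.inclusion hV) η)) : IsSmoothForm η := by
  classical
  set η' : Euc n → Euc n [⋀^Fin r]→L[ℝ] ℝ := fun z ↦ if hz : z ∈ U then η ⟨z, hz⟩ else 0 with hη'
  have h' : ∀ x : U, η' x.1 = η x := fun x ↦ dif_pos x.2
  rw [isSmoothForm_opens_iff h']
  intro z hz
  obtain ⟨V, hV, hzV, hs⟩ := h ⟨z, hz⟩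
  have h1 : ∀ x : V, η' x.1 = pullback (Opens.inclusion hV) η x := fun x ↦
    (h' (Opens.inclusion hV x)).trans (pullback_inclusion hV η x).symm
  rw [isSmoothForm_opens_iff h1] at hs
  exact (hs.contDiffAt (V.isOpen.mem_nhds hzV)).contDiffWithinAt

end

namespace Foliation

universe u

variable {p q m : ℕ} {M : Type u} [TopologicalSpace M] [ChartedSpace (Euc m) M]
  {F : Foliation p q m M}

/-! ### Tangential paths -/

theorem isTangentialPath_of_contMDiff {ν : ℝ → M} (hν : ContMDiff 𝓘(ℝ, ℝ) (𝓡 m) ∞ ν)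
    (h : ∀ t, mfderiv 𝓘(ℝ, ℝ) (𝓡 m) ν t (1 : ℝ) ∈ F.tangent (ν t)) : F.IsTangentialPath ν where
  contMDiffOn := hν.contMDiffOn
  velocity_mem t ht := by
    rw [mfderivWithin_eq_mfderiv
      (uniqueMDiffWithinAt_iff_uniqueDiffWithinAt.2 (uniqueDiffOn_Icc_zero_one t ht))
      ((hν t).mdifferentiableAt (by simp))]
    exact h t

/-- Reparametrizing by a smooth function on all of `ℝ` with values in `[0, 1]` removes the boundary
of the parameter interval. -/
theorem IsTangentialPath.contMDiff_comp {μ : ℝ → M} (hμ : F.IsTangentialPath μ) {σ : ℝ → ℝ}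
    (hσ : ContDiff ℝ ∞ σ) (h : ∀ t, σ t ∈ Set.Icc (0 : ℝ) 1) :
    ContMDiff 𝓘(ℝ, ℝ) (𝓡 m) ∞ (μ ∘ σ) := by
  rw [← contMDiffOn_univ]
  exact hμ.contMDiffOn.comp hσ.contMDiff.contMDiffOn fun t _ ↦ h t

theorem IsTangentialPath.mfderiv_comp_mem {μ : ℝ → M} (hμ : F.IsTangentialPath μ) {σ : ℝ → ℝ}
    (hσ : ContDiff ℝ ∞ σ) (h : ∀ t, σ t ∈ Set.Icc (0 : ℝ) 1) (t : ℝ) :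
    mfderiv 𝓘(ℝ, ℝ) (𝓡 m) (μ ∘ σ) t (1 : ℝ) ∈ F.tangent (μ (σ t)) := by
  have h1 := ((hμ.contMDiffOn (σ t) (h t)).mdifferentiableWithinAt (by simp)).hasMFDerivWithinAt
  have h2 := ((hσ.differentiable (by simp)) t).hasFDerivAt.hasMFDerivAt
  have h3 := (h1.comp t (h2.hasMFDerivWithinAt (s := Set.univ)) fun t _ ↦ h t)
  rw [hasMFDerivWithinAt_univ] at h3
  rw [h3.mfderiv]
  have h4 : ∀ (A : ℝ →L[ℝ] Euc m) (c : ℝ), A c = c • A 1 := fun A c ↦ by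
    rw [← A.map_smul, smul_eq_mul, mul_one]
  have h5 := (F.tangent (μ (σ t))).smul_mem (fderiv ℝ σ t (1 : ℝ)) (hμ.velocity_mem (σ t) (h t))
  exact (congrArg (· ∈ F.tangent (μ (σ t)))
    (h4 (mfderivWithin 𝓘(ℝ, ℝ) (𝓡 m) μ (Set.Icc 0 1) (σ t)) (fderiv ℝ σ t (1 : ℝ)))).mpr h5

theorem smoothTransition_mem_Icc (t : ℝ) : Real.smoothTransition t ∈ Set.Icc (0 : ℝ) 1 :=
  ⟨Real.smoothTransition.nonneg t, Real.smoothTransition.le_one t⟩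

theorem IsTangentialPath.symm {μ : ℝ → M} (hμ : F.IsTangentialPath μ) :
    ∃ ν : ℝ → M, F.IsTangentialPath ν ∧ ν 0 = μ 1 ∧ ν 1 = μ 0 := by
  have h1 : ContDiff ℝ ∞ fun t ↦ 1 - Real.smoothTransition t :=
    contDiff_const.sub Real.smoothTransition.contDiff
  have h2 : ∀ t, 1 - Real.smoothTransition t ∈ Set.Icc (0 : ℝ) 1 := fun t ↦ by
    have := smoothTransition_mem_Icc t
    constructor <;> linarith [this.1, this.2]
  refine ⟨_, isTangentialPath_of_contMDiff (hμ.contMDiff_comp h1 h2) (hμ.mfderiv_comp_mem h1 h2),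
    ?_, ?_⟩ <;> simp

/-- Concatenation of tangential paths. Both paths are slowed down to be stationary around the
junction, so that the result is smooth. -/
theorem IsTangentialPath.trans {μ₁ μ₂ : ℝ → M} (h₁ : F.IsTangentialPath μ₁)
    (h₂ : F.IsTangentialPath μ₂) (h : μ₁ 1 = μ₂ 0) :
    ∃ ν : ℝ → M, F.IsTangentialPath ν ∧ ν 0 = μ₁ 0 ∧ ν 1 = μ₂ 1 := by
  set σ₁ : ℝ → ℝ := fun t ↦ Real.smoothTransition (3 * t) with hσ₁
  set σ₂ : ℝ → ℝ := fun t ↦ Real.smoothTransition (3 * t - 2) with hσ₂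
  have hs₁ : ContDiff ℝ ∞ σ₁ := Real.smoothTransition.contDiff.comp (contDiff_const.mul contDiff_id)
  have hs₂ : ContDiff ℝ ∞ σ₂ :=
    Real.smoothTransition.contDiff.comp ((contDiff_const.mul contDiff_id).sub contDiff_const)
  have hm₁ : ∀ t, σ₁ t ∈ Set.Icc (0 : ℝ) 1 := fun t ↦ smoothTransition_mem_Icc _
  have hm₂ : ∀ t, σ₂ t ∈ Set.Icc (0 : ℝ) 1 := fun t ↦ smoothTransition_mem_Icc _
  set ν : ℝ → M := fun t ↦ if t ≤ 1 / 2 then μ₁ (σ₁ t) else μ₂ (σ₂ t) with hν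
  -- For `1/3 < t < 2/3` both branches are stationary at the junction.
  have e₁ : ∀ t < 2 / 3, ν t = (μ₁ ∘ σ₁) t := by
    intro t ht
    by_cases h' : t ≤ 1 / 2
    · exact if_pos h'
    · have a₁ : σ₁ t = 1 := Real.smoothTransition.one_of_one_le (by linarith)
      have a₂ : σ₂ t = 0 := Real.smoothTransition.zero_of_nonpos (by linarith)
      simp only [hν, if_neg h', Function.comp_apply, a₁, a₂, h]
  have e₂ : ∀ t > 1 / 3, ν t = (μ₂ ∘ σ₂) t := by
    intro t ht
    by_cases h' : t ≤ 1 / 2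
    · have a₁ : σ₁ t = 1 := Real.smoothTransition.one_of_one_le (by linarith)
      have a₂ : σ₂ t = 0 := Real.smoothTransition.zero_of_nonpos (by linarith)
      simp only [hν, if_pos h', Function.comp_apply, a₁, a₂, h]
    · exact if_neg h'
  have key : ∀ t, ContMDiffAt 𝓘(ℝ, ℝ) (𝓡 m) ∞ ν t ∧
      mfderiv 𝓘(ℝ, ℝ) (𝓡 m) ν t (1 : ℝ) ∈ F.tangent (ν t) := by
    intro t
    rcases lt_or_ge t (2 / 3) with ht | ht
    · have h' : ν =ᶠ[𝓝 t] μ₁ ∘ σ₁ := by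
        filter_upwards [isOpen_Iio.mem_nhds ht] with s hs using e₁ s hs
      refine ⟨(h₁.contMDiff_comp hs₁ hm₁ t).congr_of_eventuallyEq h', ?_⟩
      rw [h'.mfderiv_eq, h'.eq_of_nhds]
      exact h₁.mfderiv_comp_mem hs₁ hm₁ t
    · have h' : ν =ᶠ[𝓝 t] μ₂ ∘ σ₂ := by
        filter_upwards [isOpen_Ioi.mem_nhds (show (1 : ℝ) / 3 < t by linarith)] with s hs
          using e₂ s hs
      refine ⟨(h₂.contMDiff_comp hs₂ hm₂ t).congr_of_eventuallyEq h', ?_⟩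
      rw [h'.mfderiv_eq, h'.eq_of_nhds]
      exact h₂.mfderiv_comp_mem hs₂ hm₂ t
  refine ⟨ν, isTangentialPath_of_contMDiff (fun t ↦ (key t).1) fun t ↦ (key t).2, ?_, ?_⟩
  · rw [e₁ 0 (by norm_num)]
    simp [hσ₁]
  · rw [e₂ 1 (by norm_num)]
    have : σ₂ 1 = 1 := Real.smoothTransition.one_of_one_le (by norm_num)
    simp [this]

/-- Two points of the same leaf are joined by a single tangential path. -/
theorem exists_isTangentialPath_of_proj_eq {x y : M} (h : F.proj x = F.proj y) :
    ∃ μ : ℝ → M, F.IsTangentialPath μ ∧ μ 0 = x ∧ μ 1 = y := by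
  have h' : Relation.EqvGen (fun x y ↦ ∃ μ : ℝ → M, F.IsTangentialPath μ ∧ μ 0 = x ∧ μ 1 = y) x y :=
    Quotient.exact h
  clear h
  induction h' with
  | rel x y h => exact h
  | refl x =>
    refine ⟨fun _ ↦ x, isTangentialPath_of_contMDiff contMDiff_const fun t ↦ ?_, rfl, rfl⟩
    rw [mfderiv_const]
    exact (F.tangent x).zero_mem
  | symm x y _ ih =>
    obtain ⟨μ, hμ, rfl, rfl⟩ := ih
    exact hμ.symm
  | trans x y z _ _ ih₁ ih₂ =>
    obtain ⟨μ₁, h₁, rfl, rfl⟩ := ih₁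
    obtain ⟨μ₂, h₂, h, rfl⟩ := ih₂
    exact h₁.trans h₂ h.symm

/-! ### Tangential homotopies -/

/-- A form that vanishes as soon as one of its arguments is tangent to the foliation. -/
def VanishesOnTangent {r : ℕ} (F : Foliation p q m M) (η : AltField m M r) : Prop :=
  ∀ (x : M) (v : Fin r → TangentSpace (𝓡 m) x) (i : Fin r), v i ∈ F.tangent x → η x v = 0

/-- If `i_e η = 0` and `i_e dη = 0` for a constant vector `e`, then `η` has zero derivative in the
direction `e`: this is Cartan's formula for a constant vector field. -/
theorem fderiv_apply_eq_zero_of_interior_eq_zero {E : Type*} [NormedAddCommGroup E]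
    [NormedSpace ℝ E] {r : ℕ} {η : E → E [⋀^Fin r]→L[ℝ] ℝ} {z e : E}
    (hη : DifferentiableAt ℝ η z)
    (h₀ : ∀ᶠ y in 𝓝 z, ∀ (v : Fin r → E) (i : Fin r), v i = e → η y v = 0)
    (h₁ : ∀ (v : Fin (r + 1) → E) (i : Fin (r + 1)), v i = e → extDeriv η z v = 0)
    (v : Fin r → E) : fderiv ℝ (fun y ↦ η y v) z e = 0 := by
  have h := h₁ (Fin.cons e v) 0 rfl
  rw [extDeriv_apply hη, Fin.sum_univ_succ, Finset.sum_eq_zero, add_zero] at h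
  · simpa using h
  · intro i _
    have h2 : (fun y ↦ η y (i.succ.removeNth (Fin.cons e v : Fin (r + 1) → E))) =ᶠ[𝓝 z]
        fun _ ↦ 0 := by
      obtain ⟨r, rfl⟩ : ∃ s, r = s + 1 := ⟨r - 1, by have := i.2; omega⟩
      filter_upwards [h₀] with y hy
      refine hy _ 0 ?_
      simp [Fin.removeNth]
    rw [h2.fderiv_eq]
    simp

variable [IsManifold (𝓡 m) ∞ M]

/-- Invariance of the pull-back along a smooth map `G` whose derivative in the direction of
the last coordinate is tangent to the foliation. -/
theorem pullback_eq_of_tangential {n r : ℕ} {α : AltField m M r} (hα : IsSmoothForm α)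
    (h₀ : F.VanishesOnTangent α) (h₁ : F.VanishesOnTangent (extD α))
    (L : (Euc n × ℝ) ≃L[ℝ] Euc (n + 1)) {S : Set (Euc n)} (hS : IsOpen S) {G : Euc (n + 1) → M}
    (hG : ContMDiffOn (𝓡 (n + 1)) (𝓡 m) ∞ G (L.symm ⁻¹' (S ×ˢ Set.univ)))
    (htan : ∀ y ∈ S, ∀ t : ℝ,
      mfderiv (𝓡 (n + 1)) (𝓡 m) G (L (y, t)) (L (0, 1)) ∈ F.tangent (G (L (y, t))))
    {y : Euc n} (hy : y ∈ S) :
    pullback (k := n) (fun y ↦ G (L (y, 0))) α y = pullback (k := n) (fun y ↦ G (L (y, 1))) α y := by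
  set S' : Set (Euc (n + 1)) := L.symm ⁻¹' (S ×ˢ Set.univ) with hS'
  have hS'o : IsOpen S' := (hS.prod isOpen_univ).preimage L.symm.continuous
  set η : Euc (n + 1) → Euc (n + 1) [⋀^Fin r]→L[ℝ] ℝ := pullback (k := n + 1) G α with hη
  have hmem : ∀ t, L (y, t) ∈ S' := fun t ↦ by simp [hS', hy]
  have htan' : ∀ z ∈ S', mfderiv (𝓡 (n + 1)) (𝓡 m) G z (L (0, 1)) ∈ F.tangent (G z) := by
    intro z hz
    obtain ⟨⟨a, t⟩, rfl⟩ := L.surjective z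
    exact htan a (by simpa [hS'] using hz) t
  have hηs : ContDiffOn ℝ ∞ η S' := contDiffOn_pullback hα hS'o hG
  have hd : ∀ t, DifferentiableAt ℝ η (L (y, t)) := fun t ↦
    (hηs.contDiffAt (hS'o.mem_nhds (hmem t))).differentiableAt (by simp)
  have hint : ∀ z ∈ S', ∀ (v : Fin r → Euc (n + 1)) (i : Fin r), v i = L (0, 1) → η z v = 0 := by
    intro z hz v i hv
    refine h₀ (G z) _ i ?_
    have := htan' z hz
    rwa [← hv] at this
  have hint' : ∀ t, ∀ (v : Fin (r + 1) → Euc (n + 1)) (i : Fin (r + 1)), v i = L (0, 1) →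
      extDeriv η (L (y, t)) v = 0 := by
    intro t v i hv
    rw [hη, extDeriv_pullback_eq hα hS'o hG (hmem t)]
    refine h₁ (G (L (y, t))) _ i ?_
    have := htan' _ (hmem t)
    rwa [← hv] at this
  -- The contraction with the constant field `L (0, 1)` kills `η` and `dη`.
  have hconst : ∀ v, η (L (y, 0)) v = η (L (y, 1)) v := by
    intro v
    have hder : ∀ t, HasDerivAt (fun t ↦ η (L (y, t)) v) 0 t := by
      intro t
      have h2 := fderiv_apply_eq_zero_of_interior_eq_zero (hd t)
        (Filter.eventually_of_mem (hS'o.mem_nhds (hmem t)) hint) (hint' t) v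
      have h3 : HasDerivAt (fun t : ℝ ↦ L (y, t)) (L (0, 1)) t :=
        L.hasFDerivAt.comp_hasDerivAt t ((hasDerivAt_const t y).prodMk (hasDerivAt_id t))
      have h4 : DifferentiableAt ℝ (fun z ↦ η z v) (L (y, t)) :=
        (hd t).continuousAlternatingMap_apply fun _ ↦ differentiableAt_const _
      have h5 := h4.hasFDerivAt.comp_hasDerivAt t h3
      rwa [h2] at h5
    exact is_const_of_deriv_eq_zero (fun t ↦ (hder t).differentiableAt)
      (fun t ↦ (hder t).deriv) 0 1
  have hslice : ∀ t : ℝ, ∀ v : Fin r → Euc n,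
      (pullback (k := n) (fun y ↦ G (L (y, t))) α y : Euc n [⋀^Fin r]→L[ℝ] ℝ) v =
        η (L (y, t)) fun i ↦ L (v i, 0) := by
    intro t v
    have h2 : HasFDerivAt (fun y : Euc n ↦ L (y, t))
        ((L : (Euc n × ℝ) →L[ℝ] Euc (n + 1)).comp (ContinuousLinearMap.inl ℝ (Euc n) ℝ)) y :=
      L.hasFDerivAt.comp y (hasFDerivAt_prodMk_left y t)
    have h3 : MDifferentiableAt (𝓡 (n + 1)) (𝓡 m) G (L (y, t)) :=
      (hG.contMDiffAt (hS'o.mem_nhds (hmem t))).mdifferentiableAt (by simp)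
    have h4 := pullback_comp (g := fun y : Euc n ↦ L (y, t)) (f := G) (x := y) h3
      h2.hasMFDerivAt.mdifferentiableAt α
    refine (DFunLike.congr_fun h4 v).trans ?_
    refine congrArg (η (L (y, t))) (funext fun i ↦ ?_)
    exact DFunLike.congr_fun h2.hasMFDerivAt.mfderiv (v i)
  refine ContinuousAlternatingMap.ext fun v ↦ ?_
  exact (hslice 0 v).trans ((hconst _).trans (hslice 1 v).symm)

/-- On a `Q`-foliation, smooth maps with the same projection to the space of leaves pull back basic
forms to the same form. -/
theorem IsQFoliation.pullback_eq (hF : F.IsQFoliation) {r : ℕ} {α : AltField m M r}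
    (hα : IsSmoothForm α) (h₀ : F.VanishesOnTangent α) (h₁ : F.VanishesOnTangent (extD α))
    {n : ℕ} {X : Type} [TopologicalSpace X] [ChartedSpace (Euc n) X] [IsManifold (𝓡 n) ∞ X]
    [T2Space X] [SecondCountableTopology X] {β γ : X → M} (hβ : ContMDiff (𝓡 n) (𝓡 m) ∞ β)
    (hγ : ContMDiff (𝓡 n) (𝓡 m) ∞ γ) (h : F.proj ∘ β = F.proj ∘ γ) :
    pullback (k := n) β α = pullback (k := n) γ α := by
  funext x
  obtain ⟨μ, hμ, hμ0, hμ1⟩ := exists_isTangentialPath_of_proj_eq (congrFun h x)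
  obtain ⟨U, H, hU, hxU, hH, hH01, -, hHt⟩ := hF n X x β γ hβ hγ h μ hμ hμ0 hμ1
  let L : (Euc n × ℝ) ≃L[ℝ] Euc (n + 1) := ContinuousLinearEquiv.ofFinrankEq (by simp)
  set e := extChartAt (𝓡 n) x with he
  set S : Set (Euc n) := e.target ∩ e.symm ⁻¹' U with hS
  have hSo : IsOpen S :=
    (continuousOn_extChartAt_symm x).isOpen_inter_preimage (isOpen_extChartAt_target x) hU
  have hxS : e x ∈ S := ⟨mem_extChartAt_target x, by simpa [he] using hxU⟩
  -- The reparametrization by `smoothTransition` makes `G` smooth beyond the interval `[0, 1]`.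
  set G : Euc (n + 1) → M := fun z ↦
    H (e.symm (L.symm z).1) (Real.smoothTransition (L.symm z).2) with hGdef
  have hσ : ContDiff ℝ ∞ Real.smoothTransition := Real.smoothTransition.contDiff
  have hG : ContMDiffOn (𝓡 (n + 1)) (𝓡 m) ∞ G (L.symm ⁻¹' (S ×ˢ Set.univ)) := by
    have a₁ : ContMDiff (𝓡 (n + 1)) (𝓡 n) ∞ fun z ↦ (L.symm z).1 :=
      (contDiff_fst.comp L.symm.contDiff).contMDiff
    have a₂ : ContMDiff (𝓡 (n + 1)) 𝓘(ℝ, ℝ) ∞ fun z ↦ Real.smoothTransition (L.symm z).2 :=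
      (hσ.comp (contDiff_snd.comp L.symm.contDiff)).contMDiff
    have a₃ : ContMDiffOn (𝓡 (n + 1)) (𝓡 n) ∞ (fun z ↦ e.symm (L.symm z).1)
        (L.symm ⁻¹' (S ×ˢ Set.univ)) :=
      (contMDiffOn_extChartAt_symm x).comp a₁.contMDiffOn fun z hz ↦ hz.1.1
    exact hH.comp (a₃.prodMk a₂.contMDiffOn) fun z hz ↦
      ⟨hz.1.2, smoothTransition_mem_Icc _⟩
  have htan : ∀ y ∈ S, ∀ t : ℝ,
      mfderiv (𝓡 (n + 1)) (𝓡 m) G (L (y, t)) (L (0, 1)) ∈ F.tangent (G (L (y, t))) := by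
    intro y hy t
    have b₁ : HasFDerivAt (fun t : ℝ ↦ L (y, t))
        ((L : (Euc n × ℝ) →L[ℝ] Euc (n + 1)).comp (ContinuousLinearMap.inr ℝ (Euc n) ℝ)) t :=
      L.hasFDerivAt.comp t (hasFDerivAt_prodMk_right y t)
    have b₂ : MDifferentiableAt (𝓡 (n + 1)) (𝓡 m) G (L (y, t)) :=
      (hG.contMDiffAt (((hSo.prod isOpen_univ).preimage L.symm.continuous).mem_nhds
        (by simpa using hy))).mdifferentiableAt (by simp)
    have b₃ := mfderiv_comp t b₂ b₁.hasMFDerivAt.mdifferentiableAt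
    have b₄ : G ∘ (fun t : ℝ ↦ L (y, t)) = H (e.symm y) ∘ Real.smoothTransition := by
      funext t
      simp [hGdef]
    have b₅ := (hHt _ hy.2).mfderiv_comp_mem hσ smoothTransition_mem_Icc t
    rw [← b₄, b₃, b₁.hasMFDerivAt.mfderiv] at b₅
    have b₆ : H (e.symm y) (Real.smoothTransition t) = G (L (y, t)) := (congrFun b₄ t).symm
    rw [b₆] at b₅
    exact b₅
  have key := pullback_eq_of_tangential hα h₀ h₁ L hSo hG htan hxS
  -- At the ends of the homotopy, transport the result from the chart back to `X`.
  have hcomp : ∀ (t : ℝ) (β : X → M), ContMDiff (𝓡 n) (𝓡 m) ∞ β →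
      (∀ y ∈ U, H y (Real.smoothTransition t) = β y) →
      pullback (k := n) β α x =
        pullback (k := n) e (pullback (k := n) (fun y ↦ G (L (y, t))) α) x := by
    intro t β hβ ht
    have c₁ : (fun y ↦ G (L (y, t))) =ᶠ[𝓝 (e x)] β ∘ e.symm := by
      filter_upwards [hSo.mem_nhds hxS] with y hy
      simpa [hGdef] using ht _ hy.2
    have c₂ : β =ᶠ[𝓝 x] (fun y ↦ G (L (y, t))) ∘ e := by
      filter_upwards [(continuousAt_extChartAt x).preimage_mem_nhds (hSo.mem_nhds hxS),
        extChartAt_source_mem_nhds (I := 𝓡 n) x] with y hy hy'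
      have := ht _ hy.2
      rw [e.left_inv hy'] at this
      simpa [hGdef, e.left_inv hy'] using this.symm
    rw [pullback_congr c₂]
    refine pullback_comp ?_ (mdifferentiableAt_extChartAt (mem_chart_source _ _)) α
    refine MDifferentiableAt.congr_of_eventuallyEq ?_ c₁
    exact ((hβ _).mdifferentiableAt (by simp)).comp _ <|
      ((contMDiffOn_extChartAt_symm (n := ∞) x).contMDiffAt
        (extChartAt_target_mem_nhds (I := 𝓡 n) x)).mdifferentiableAt (by simp)
  rw [hcomp 0 β hβ fun y hy ↦ by simpa using (hH01 y hy).1,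
    hcomp 1 γ hγ fun y hy ↦ by simpa using (hH01 y hy).2]
  show ContinuousAlternatingMap.compContinuousLinearMap _ _ =
    ContinuousAlternatingMap.compContinuousLinearMap _ _
  rw [key]

end Foliation

section

universe u

variable {p q m : ℕ} {M : Type u} [TopologicalSpace M] [ChartedSpace (Euc m) M]

/-! ### Adapted charts -/

section

variable {T : (x : M) → Submodule ℝ (TangentSpace (𝓡 m) x)}
  {φ : OpenPartialHomeomorph M (Euc p × Euc q)}

theorem IsAdaptedChart.mdifferentiable (hφ : IsAdaptedChart T φ) :
    φ.MDifferentiable (𝓡 m) 𝓘(ℝ, Euc p × Euc q) :=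
  ⟨hφ.contMDiffOn.mdifferentiableOn (by simp), hφ.contMDiffOn_symm.mdifferentiableOn (by simp)⟩

theorem IsAdaptedChart.mem_iff_snd (hφ : IsAdaptedChart T φ) {y : M} (hy : y ∈ φ.source)
    (v : TangentSpace (𝓡 m) y) :
    v ∈ T y ↔ (mfderiv (𝓡 m) 𝓘(ℝ, Euc p × Euc q) φ y v : Euc p × Euc q).2 = 0 := by
  rw [hφ.mem_iff y hy]
  have h1 := mfderiv_comp y
    (differentiableAt_snd (𝕜 := ℝ) (p := φ y)).hasFDerivAt.hasMFDerivAt.mdifferentiableAt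
    (hφ.mdifferentiable.mdifferentiableAt hy)
  have h2 : (Prod.snd : Euc p × Euc q → Euc q) ∘ φ = fun z ↦ (φ z).2 := rfl
  rw [h2, mfderiv_eq_fderiv, fderiv_snd] at h1
  rw [h1]
  rfl

theorem IsAdaptedChart.mfderiv_symm_mem (hφ : IsAdaptedChart T φ) {z : Euc p × Euc q}
    (hz : z ∈ φ.target) (w : Euc p) :
    mfderiv 𝓘(ℝ, Euc p × Euc q) (𝓡 m) φ.symm z ((w, 0) : Euc p × Euc q) ∈ T (φ.symm z) := by
  rw [hφ.mem_iff_snd (φ.map_target hz)]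
  have h1 := hφ.mdifferentiable.comp_symm_deriv hz
  have h2 := DFunLike.congr_fun h1 ((w, 0) : Euc p × Euc q)
  exact congrArg Prod.snd h2

/-- The constant vector fields along the plaques, in an adapted chart, are smooth. -/
theorem IsAdaptedChart.contMDiffOn_mfderiv_symm [IsManifold (𝓡 m) ∞ M] (hφ : IsAdaptedChart T φ)
    (w : Euc p × Euc q) :
    ContMDiffOn (𝓡 m) (𝓡 m).tangent ∞ (fun y ↦ (⟨φ.symm (φ y),
      mfderiv 𝓘(ℝ, Euc p × Euc q) (𝓡 m) φ.symm (φ y) w⟩ : TangentBundle (𝓡 m) M)) φ.source := by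
  have h1 : ContMDiff 𝓘(ℝ, Euc p × Euc q) 𝓘(ℝ, Euc p × Euc q).tangent ∞
      (fun z ↦ (⟨z, w⟩ : TangentBundle 𝓘(ℝ, Euc p × Euc q) (Euc p × Euc q))) :=
    contMDiff_vectorSpace_iff_contDiff.2 contDiff_const
  have h2 := hφ.contMDiffOn_symm.contMDiffOn_tangentMapWithin (m := ∞) (by simp)
    φ.open_target.uniqueMDiffOn
  have h3 := h2.comp (h1.comp_contMDiffOn hφ.contMDiffOn) fun y hy ↦ φ.map_source hy
  refine h3.congr fun y hy ↦ ?_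
  simp only [Function.comp_apply, tangentMapWithin,
    mfderivWithin_of_isOpen φ.open_target (φ.map_source hy)]

end

namespace Foliation

variable (F : Foliation p q m M)

/-- Every tangent vector of the foliation extends to a smooth vector field on `M` tangent to the
foliation: multiply a constant field in an adapted chart by a bump function. -/
theorem exists_isTangentField [IsManifold (𝓡 m) ∞ M] [T2Space M] {x : M}
    {v : TangentSpace (𝓡 m) x} (hv : v ∈ F.tangent x) : ∃ X, F.IsTangentField X ∧ X x = v := by
  obtain ⟨φ, hx, hφ⟩ := F.exists_adapted x
  obtain ⟨f, -, hf⟩ := (SmoothBumpFunction.nhds_basis_tsupport (I := 𝓡 m) x).mem_iff.1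
    (φ.open_source.mem_nhds hx)
  have hw := (hφ.mem_iff_snd hx v).1 hv
  set w : Euc p × Euc q := mfderiv (𝓡 m) 𝓘(ℝ, Euc p × Euc q) φ x v with hwdef
  let Y : (y : M) → TangentSpace (𝓡 m) y :=
    fun y ↦ mfderiv 𝓘(ℝ, Euc p × Euc q) (𝓡 m) φ.symm (φ y) w
  refine ⟨fun y ↦ f y • Y y, ⟨?_, fun y ↦ ?_⟩, ?_⟩
  · refine ContMDiffOn.smul_section_of_tsupport (s := Y) f.contMDiff.contMDiffOn φ.open_source hf ?_
    refine (hφ.contMDiffOn_mfderiv_symm w).congr fun y hy ↦ ?_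
    have : ∀ z, z = y → (⟨y, Y y⟩ : TangentBundle (𝓡 m) M) =
        ⟨z, mfderiv 𝓘(ℝ, Euc p × Euc q) (𝓡 m) φ.symm (φ y) w⟩ := by
      rintro z rfl
      rfl
    exact this _ (φ.left_inv hy)
  · by_cases hy : y ∈ φ.source
    · refine (F.tangent y).smul_mem _ ?_
      have h1 := hφ.mfderiv_symm_mem (φ.map_source hy) w.1
      have h2 : w = (w.1, 0) := Prod.ext rfl hw
      rw [← h2] at h1
      have : ∀ z (h : z = y), (mfderiv 𝓘(ℝ, Euc p × Euc q) (𝓡 m) φ.symm (φ y) w : Euc m) ∈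
          (F.tangent z : Submodule ℝ (Euc m)) → Y y ∈ F.tangent y := by
        rintro z rfl h
        exact h
      exact this _ (φ.left_inv hy) h1
    · have : f y = 0 := image_eq_zero_of_notMem_tsupport fun h ↦ hy (hf h)
      show f y • Y y ∈ _
      rw [this, zero_smul]
      exact (F.tangent y).zero_mem
  · have h1 := DFunLike.congr_fun (hφ.mdifferentiable.symm_comp_deriv hx) v
    show f x • Y x = v
    rw [f.eq_one, one_smul]
    exact h1

theorem vanishesOnTangent_of_interiorVanishes [IsManifold (𝓡 m) ∞ M] [T2Space M] {r : ℕ}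
    {η : AltField m M r} (h : ∀ X, F.IsTangentField X → InteriorVanishes X η) :
    F.VanishesOnTangent η := by
  intro x v i hv
  obtain ⟨X, hX, hXv⟩ := F.exists_isTangentField hv
  exact h X hX x v i hXv.symm

variable {F} in
theorem VanishesOnTangent.interiorVanishes [IsManifold (𝓡 m) ∞ M] {r : ℕ} {η : AltField m M r}
    (h : F.VanishesOnTangent η) {X : (x : M) → TangentSpace (𝓡 m) x} (hX : F.IsTangentField X) :
    InteriorVanishes X η :=
  fun x v i hv ↦ h x v i (hv ▸ hX.mem_tangent x)

/-- Points of the same plaque are on the same leaf: the segments inside of a plaque are tangential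
paths. -/
theorem proj_symm_eq {φ : OpenPartialHomeomorph M (Euc p × Euc q)}
    (hφ : IsAdaptedChart F.tangent φ) {a b : Euc p} {c : Euc q} (ha : (a, c) ∈ φ.target)
    (hb : (b, c) ∈ φ.target) : F.proj (φ.symm (a, c)) = F.proj (φ.symm (b, c)) := by
  obtain ⟨U, W, -, -, hUc, -, hUW⟩ := hφ.target_eq_prod
  rw [hUW] at ha hb
  set l : ℝ → Euc p × Euc q := fun t ↦ (a + t • (b - a), c) with hl
  have hl' : ∀ t, HasFDerivAt l
      (ContinuousLinearMap.toSpanSingleton ℝ ((b - a, 0) : Euc p × Euc q)) t := by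
    intro t
    have h1 : HasDerivAt (fun t : ℝ ↦ a + t • (b - a)) (b - a) t := by
      simpa using ((hasDerivAt_id t).smul_const (b - a)).const_add a
    exact (h1.prodMk (hasDerivAt_const t c)).hasFDerivAt
  have hls : ContDiff ℝ ∞ l :=
    (contDiff_const.add (contDiff_id.smul contDiff_const)).prodMk contDiff_const
  have hmem : ∀ t ∈ Set.Icc (0 : ℝ) 1, l t ∈ φ.target := by
    intro t ht
    rw [hUW]
    exact ⟨hUc.add_smul_sub_mem ha.1 hb.1 ht, ha.2⟩
  refine Quotient.sound (Relation.EqvGen.rel _ _ ⟨φ.symm ∘ l, ⟨?_, ?_⟩, by simp [hl], by simp [hl]⟩)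
  · exact hφ.contMDiffOn_symm.comp hls.contMDiff.contMDiffOn hmem
  · intro t ht
    have h1 := hφ.mdifferentiable.mdifferentiableAt_symm (hmem t ht)
    have h2 := (hl' t).hasMFDerivAt
    rw [mfderivWithin_eq_mfderiv
      (uniqueMDiffWithinAt_iff_uniqueDiffWithinAt.2 (uniqueDiffOn_Icc_zero_one t ht))
      (h1.comp t h2.mdifferentiableAt), mfderiv_comp t h1 h2.mdifferentiableAt, h2.mfderiv]
    have h3 := hφ.mfderiv_symm_mem (hmem t ht) (b - a)
    have h4 : ∀ A : (Euc p × Euc q) →L[ℝ] Euc m,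
        A.comp (ContinuousLinearMap.toSpanSingleton ℝ ((b - a, 0) : Euc p × Euc q)) 1 =
          A (b - a, 0) := fun A ↦ by simp
    exact (congrArg (· ∈ F.tangent (φ.symm (l t)))
      (h4 (mfderiv 𝓘(ℝ, Euc p × Euc q) (𝓡 m) φ.symm (l t)))).mpr h3

/-- The local retraction onto the transversal through `x`, along the plaques of an adapted chart. It
does not change the leaf, and its differential kills the tangent space of the foliation. -/
theorem exists_retraction (x : M) : ∃ (O : Set M) (s : M → M), IsOpen O ∧ x ∈ O ∧
    ContMDiffOn (𝓡 m) (𝓡 m) ∞ s O ∧ s x = x ∧ (∀ y ∈ O, F.proj (s y) = F.proj y) ∧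
    ∀ v ∈ F.tangent x, mfderiv (𝓡 m) (𝓡 m) s x v = 0 := by
  obtain ⟨φ, hx, hφ⟩ := F.exists_adapted x
  obtain ⟨U, W, -, -, -, -, hUW⟩ := hφ.target_eq_prod
  have hmem : ∀ y ∈ φ.source, ((φ x).1, (φ y).2) ∈ φ.target := by
    intro y hy
    have h1 := φ.map_source hx
    have h2 := φ.map_source hy
    rw [hUW] at h1 h2 ⊢
    exact ⟨h1.1, h2.2⟩
  have hφ2 : ContMDiffOn (𝓡 m) (𝓡 q) ∞ (fun y ↦ (φ y).2) φ.source :=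
    contDiff_snd.contMDiff.comp_contMDiffOn hφ.contMDiffOn
  have hj : ContDiff ℝ ∞ fun c : Euc q ↦ ((φ x).1, c) := contDiff_const.prodMk contDiff_id
  refine ⟨φ.source, fun y ↦ φ.symm ((φ x).1, (φ y).2), φ.open_source, hx, ?_, ?_, ?_, ?_⟩
  · exact hφ.contMDiffOn_symm.comp (hj.contMDiff.comp_contMDiffOn hφ2) hmem
  · exact φ.left_inv hx
  · intro y hy
    rw [F.proj_symm_eq hφ (hmem y hy) (φ.map_source hy)]
    exact congrArg F.proj (φ.left_inv hy)
  · intro v hv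
    have h1 : MDifferentiableAt (𝓡 q) (𝓡 m) (fun c : Euc q ↦ φ.symm ((φ x).1, c)) (φ x).2 :=
      MDifferentiableAt.comp (I' := 𝓘(ℝ, Euc p × Euc q)) (φ x).2
        (hφ.mdifferentiable.mdifferentiableAt_symm (hmem x hx))
        (hj.contMDiff.mdifferentiableAt (by simp))
    have h2 : MDifferentiableAt (𝓡 m) (𝓡 q) (fun y ↦ (φ y).2) x :=
      (hφ2.contMDiffAt (φ.open_source.mem_nhds hx)).mdifferentiableAt (by simp)
    have h3 := mfderiv_comp x h1 h2
    refine (DFunLike.congr_fun h3 v).trans ?_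
    refine (congrArg (mfderiv (𝓡 q) (𝓡 m) (fun c : Euc q ↦ φ.symm ((φ x).1, c)) (φ x).2)
      ((hφ.mem_iff x hx v).1 hv)).trans ?_
    exact map_zero _

end Foliation

end

section

universe u

variable {p q m n k r : ℕ} {M : Type u} [TopologicalSpace M] [ChartedSpace (Euc m) M]

/-! ### Restriction to smaller parameter domains -/

/-- The preimage of an open set under a continuous map defined on an open subset of Euclidean space,
as an open subset of Euclidean space. -/
def preimageOpens {Y : Type*} [TopologicalSpace Y] {V : Opens (Euc k)} {f : V → Y}
    (hf : Continuous f) (O : Opens Y) : Opens (Euc k) :=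
  ⟨Subtype.val '' (f ⁻¹' O), V.isOpen.isOpenMap_subtype_val _ (O.isOpen.preimage hf)⟩

theorem preimageOpens_le {Y : Type*} [TopologicalSpace Y] {V : Opens (Euc k)} {f : V → Y}
    (hf : Continuous f) (O : Opens Y) : preimageOpens hf O ≤ V := by
  rintro _ ⟨v, -, rfl⟩
  exact v.2

theorem apply_inclusion_preimageOpens_mem {Y : Type*} [TopologicalSpace Y] {V : Opens (Euc k)}
    {f : V → Y} (hf : Continuous f) (O : Opens Y) (s : preimageOpens hf O) :
    f (Opens.inclusion (preimageOpens_le hf O) s) ∈ O := by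
  obtain ⟨_, v, hv, rfl⟩ := s
  exact hv

theorem pullback_comp_inclusion {U V : Opens (Euc k)} (h : U ≤ V) {f : V → M}
    (hf : ContMDiff (𝓡 k) (𝓡 m) ∞ f) (η : AltField m M r) (x : U) :
    (pullback (k := k) (f ∘ Opens.inclusion h) η x : Euc k [⋀^Fin r]→L[ℝ] ℝ) =
      pullback (k := k) f η (Opens.inclusion h x) :=
  (pullback_comp ((hf _).mdifferentiableAt (by simp))
    ((contMDiff_inclusion (n := ∞) h x).mdifferentiableAt (by simp)) η).trans
    (pullback_inclusion h _ x)

theorem pullback_id {N : Type*} [TopologicalSpace N] [ChartedSpace (Euc n) N] (η : AltField n N r) :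
    pullback (k := n) id η = η := by
  funext x
  refine ContinuousAlternatingMap.ext fun v ↦ ?_
  refine congrArg (η x : Euc n [⋀^Fin r]→L[ℝ] ℝ) (funext fun i ↦ ?_)
  exact DFunLike.congr_fun (mfderiv_id (I := 𝓡 n) (x := x)) (v i)

/-! ### Forms and their expressions in charts -/

/-- The parametrization of a part of a manifold by the inverse of the preferred chart at `x`. -/
def chartParam (x : M) (V : Opens (Euc m)) : V → M :=
  (extChartAt (𝓡 m) x).symm ∘ Subtype.val

theorem contMDiff_chartParam [IsManifold (𝓡 m) ∞ M] {x : M} {V : Opens (Euc m)}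
    (hV : (V : Set (Euc m)) ⊆ (extChartAt (𝓡 m) x).target) :
    ContMDiff (𝓡 m) (𝓡 m) ∞ (chartParam x V) := by
  rw [← contMDiffOn_univ]
  exact (contMDiffOn_extChartAt_symm x).comp contMDiff_subtype_val.contMDiffOn fun z _ ↦ hV z.2

theorem pullback_chartParam [IsManifold (𝓡 m) ∞ M] {x : M} {V : Opens (Euc m)}
    (hV : (V : Set (Euc m)) ⊆ (extChartAt (𝓡 m) x).target) (η : AltField m M r) (z : V) :
    (pullback (k := m) (chartParam x V) η z : Euc m [⋀^Fin r]→L[ℝ] ℝ) = coord η x z := by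
  have h1 : MDifferentiableAt (𝓡 m) (𝓡 m) (extChartAt (𝓡 m) x).symm z.1 :=
    ((contMDiffOn_extChartAt_symm (n := ∞) x).contMDiffAt
      ((isOpen_extChartAt_target x).mem_nhds (hV z.2))).mdifferentiableAt (by simp)
  exact (pullback_comp h1 (hasMFDerivAt_subtype_val z).mdifferentiableAt η).trans
    (pullback_subtype_val _ z)

theorem eq_coord_compContinuousLinearMap [IsManifold (𝓡 m) ∞ M] (η : AltField m M r) (x : M) :
    η x = (coord η x (extChartAt (𝓡 m) x x)).compContinuousLinearMap
      (mfderiv (𝓡 m) (𝓡 m) (extChartAt (𝓡 m) x) x) := by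
  have h1 : MDifferentiableAt (𝓡 m) (𝓡 m) (extChartAt (𝓡 m) x).symm (extChartAt (𝓡 m) x x) :=
    ((contMDiffOn_extChartAt_symm (n := ∞) x).contMDiffAt
      (extChartAt_target_mem_nhds (I := 𝓡 m) x)).mdifferentiableAt (by simp)
  have h2 : (extChartAt (𝓡 m) x).symm ∘ extChartAt (𝓡 m) x =ᶠ[𝓝 x] id := by
    filter_upwards [extChartAt_source_mem_nhds (I := 𝓡 m) x] with y hy
    exact (extChartAt (𝓡 m) x).left_inv hy
  have h3 := pullback_congr (k := m) (n := m) h2 η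
  rw [pullback_id] at h3
  exact h3.symm.trans
    (pullback_comp h1 (mdifferentiableAt_extChartAt (mem_chart_source _ _)) η)

theorem eq_of_pullback_chartParam_eq [IsManifold (𝓡 m) ∞ M] {η η' : AltField m M r} {x : M}
    {V : Opens (Euc m)} (hV : (V : Set (Euc m)) ⊆ (extChartAt (𝓡 m) x).target)
    (hx : extChartAt (𝓡 m) x x ∈ V)
    (h : pullback (k := m) (chartParam x V) η ⟨_, hx⟩ =
      pullback (k := m) (chartParam x V) η' ⟨_, hx⟩) : η x = η' x := by
  have h1 : coord η x (extChartAt (𝓡 m) x x) = coord η' x (extChartAt (𝓡 m) x x) :=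
    (pullback_chartParam hV η ⟨_, hx⟩).symm.trans (h.trans (pullback_chartParam hV η' ⟨_, hx⟩))
  rw [eq_coord_compContinuousLinearMap η x, eq_coord_compContinuousLinearMap η' x, h1]

/-- A form on a manifold is determined by its pull-backs under smooth maps from open subsets of
Euclidean space. -/
theorem ext_of_pullback_eq [IsManifold (𝓡 m) ∞ M] {η η' : AltField m M r}
    (h : ∀ (U : Opens (Euc m)) (β : U → M), ContMDiff (𝓡 m) (𝓡 m) ∞ β →
      pullback (k := m) β η = pullback (k := m) β η') : η = η' := by
  funext x
  exact eq_of_pullback_chartParam_eq (V := ⟨_, isOpen_extChartAt_target x⟩) le_rfl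
    (mem_extChartAt_target x) (congrFun (h _ _ (contMDiff_chartParam le_rfl)) _)

namespace Diffeology

theorem forms_apply_eq_pullback {X : Type u} {D : Diffeology X} (θ : D.forms r) {U : Opens (Euc n)}
    {V : Opens (Euc k)} (α : D.Plots U) (α' : D.Plots V) {h : V → U}
    (hh : ContMDiff (𝓡 k) (𝓡 n) ∞ h) (hα : α'.1 = α.1 ∘ h) :
    (θ.1 k V α').1 = pullback h (θ.1 n U α).1 := by
  obtain ⟨α', h'⟩ := α'
  subst hα
  exact θ.2 α h hh

end Diffeology

namespace Foliation

variable (F : Foliation p q m M)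

/-! ### From forms of the quotient diffeology to basic forms -/

section Descent

variable [IsManifold (𝓡 m) ∞ M]

/-- The component of a form of the quotient diffeology at the plot `π ∘ β`. -/
def component (θ : F.quotientDiffeology.forms r) {U : Opens (Euc n)} {β : U → M}
    (hβ : ContMDiff (𝓡 n) (𝓡 m) ∞ β) : AltField n U r :=
  (θ.1 n U ⟨F.proj ∘ β, F.isPlot_proj_comp hβ⟩).1

/-- The form on `M` that is given in the chart at `x` by the component at the plot
`π ∘ (inverse of the chart)`. -/
def descent (θ : F.quotientDiffeology.forms r) : AltField m M r := fun x ↦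
  ContinuousAlternatingMap.compContinuousLinearMap
    (F.component θ (contMDiff_chartParam (x := x) (V := ⟨_, isOpen_extChartAt_target x⟩) le_rfl)
      ⟨extChartAt (𝓡 m) x x, mem_extChartAt_target x⟩ : Euc m [⋀^Fin r]→L[ℝ] ℝ)
    (mfderiv (𝓡 m) (𝓡 m) (extChartAt (𝓡 m) x) x)

/-- The defining property `β^*(Bθ) = θ_(π ∘ β)`: around `t`, the map `γ` is the inverse of the chart
at `γ t` composed with the coordinate expression of `γ`. -/
theorem pullback_descent (θ : F.quotientDiffeology.forms r) {V : Opens (Euc n)} {γ : V → M}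
    (hγ : ContMDiff (𝓡 n) (𝓡 m) ∞ γ) :
    pullback (k := n) γ (F.descent θ) = F.component θ hγ := by
  funext t
  set x := γ t with hx
  set e := extChartAt (𝓡 m) x with he
  set O : Opens M := ⟨e.source, isOpen_extChartAt_source x⟩ with hO
  set U : Opens (Euc m) := ⟨e.target, isOpen_extChartAt_target x⟩ with hU
  set V' := preimageOpens hγ.continuous O with hV'
  set i := Opens.inclusion (preimageOpens_le hγ.continuous O) with hi
  have hi' : ContMDiff (𝓡 n) (𝓡 n) ∞ i := contMDiff_inclusion _
  have hmem : ∀ s : V', γ (i s) ∈ e.source :=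
    apply_inclusion_preimageOpens_mem hγ.continuous O
  let h : V' → U := fun s ↦ ⟨e (γ (i s)), e.map_source (hmem s)⟩
  have hh : ContMDiff (𝓡 n) (𝓡 m) ∞ h := by
    refine (ContMDiff.subtypeVal_comp_iff U _).1 ?_
    rw [← contMDiffOn_univ]
    refine (contMDiffOn_extChartAt (x := x)).comp (hγ.comp hi').contMDiffOn fun s _ ↦ ?_
    have := hmem s
    rwa [he, extChartAt_source] at this
  have hβ := contMDiff_chartParam (x := x) (V := U) le_rfl
  have h1 : chartParam x U ∘ h = γ ∘ i := funext fun s ↦ e.left_inv (hmem s)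
  have hγi : ContMDiff (𝓡 n) (𝓡 m) ∞ (γ ∘ i) := hγ.comp hi'
  have h2 : F.component θ hγi = pullback (k := n) h (F.component θ hβ) :=
    Diffeology.forms_apply_eq_pullback θ ⟨_, F.isPlot_proj_comp hβ⟩ ⟨_, F.isPlot_proj_comp hγi⟩ hh
      (congrArg (F.proj ∘ ·) h1).symm
  have h3 : F.component θ hγi = pullback (k := n) i (F.component θ hγ) :=
    Diffeology.forms_apply_eq_pullback θ ⟨_, F.isPlot_proj_comp hγ⟩ ⟨_, F.isPlot_proj_comp hγi⟩ hi'
      rfl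
  have ht : t.1 ∈ V' := ⟨t, mem_extChartAt_source x, rfl⟩
  have h4 := congrFun (h3.symm.trans h2) ⟨t.1, ht⟩
  refine Eq.trans ?_ ((pullback_inclusion _ _ _).symm.trans h4).symm
  have h5 : mfderiv (𝓡 n) (𝓡 m) h ⟨t.1, ht⟩ =
      (mfderiv (𝓡 m) (𝓡 m) e x).comp (mfderiv (𝓡 n) (𝓡 m) γ t) := by
    have a₁ : MDifferentiableAt (𝓡 m) (𝓡 m) e (γ t) :=
      mdifferentiableAt_extChartAt (mem_chart_source _ _)
    have a₂ : MDifferentiableAt (𝓡 n) (𝓡 m) γ (i ⟨t.1, ht⟩) :=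
      (hγ _).mdifferentiableAt (by simp)
    have a₃ : MDifferentiableAt (𝓡 n) (𝓡 n) i ⟨t.1, ht⟩ := (hi' _).mdifferentiableAt (by simp)
    have b₁ := mfderiv_comp (⟨t.1, ht⟩ : V') (g := e) (f := γ ∘ i) a₁ (a₂.comp _ a₃)
    have b₂ := mfderiv_comp (⟨t.1, ht⟩ : V') a₂ a₃
    have b₃ := mfderiv_comp (⟨t.1, ht⟩ : V') (hasMFDerivAt_subtype_val _).mdifferentiableAt
      ((hh ⟨t.1, ht⟩).mdifferentiableAt (by simp))
    have b₄ : Subtype.val ∘ h = e ∘ γ ∘ i := rfl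
    rw [mfderiv_subtype_val, b₄, b₁, b₂, mfderiv_inclusion] at b₃
    exact b₃.symm
  refine ContinuousAlternatingMap.ext fun v ↦ ?_
  refine congrArg (F.component θ hβ ⟨e x, mem_extChartAt_target x⟩ : Euc m [⋀^Fin r]→L[ℝ] ℝ)
    (funext fun j ↦ ?_)
  exact (DFunLike.congr_fun h5 (v j)).symm

theorem isSmoothForm_descent (θ : F.quotientDiffeology.forms r) : IsSmoothForm (F.descent θ) := by
  intro x
  set U : Opens (Euc m) := ⟨_, isOpen_extChartAt_target (I := 𝓡 m) x⟩ with hU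
  have hβ := contMDiff_chartParam (x := x) (V := U) le_rfl
  refine (isSmoothForm_opens_iff (U := U) (η := F.component θ hβ) fun z ↦ ?_).1
    (θ.1 m U ⟨_, F.isPlot_proj_comp hβ⟩).2
  rw [← F.pullback_descent θ hβ]
  exact (pullback_chartParam le_rfl _ z).symm

theorem extD_descent (θ : F.quotientDiffeology.forms r) :
    extD (F.descent θ) = F.descent (F.quotientDiffeology.d θ) := by
  refine ext_of_pullback_eq fun U β hβ ↦ ?_
  rw [← extD_pullback (F.isSmoothForm_descent θ) hβ, F.pullback_descent _ hβ,
    F.pullback_descent _ hβ]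
  rfl

/-- For `β` with values near `x`, the plots `π ∘ β` and `π ∘ s ∘ β` agree, where `s` is the retraction
onto a transversal. So the form equals its own pull-back under `s`. -/
theorem vanishesOnTangent_descent (θ : F.quotientDiffeology.forms r) :
    F.VanishesOnTangent (F.descent θ) := by
  intro x v i hv
  obtain ⟨O, s, hO, hxO, hs, -, hproj, hker⟩ := F.exists_retraction x
  set e := extChartAt (𝓡 m) x with he
  set V : Opens (Euc m) := ⟨e.target ∩ e.symm ⁻¹' O,
    (continuousOn_extChartAt_symm x).isOpen_inter_preimage (isOpen_extChartAt_target x) hO⟩ with hVdef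
  have hV : (V : Set (Euc m)) ⊆ e.target := Set.inter_subset_left
  have hxV : e x ∈ V := ⟨mem_extChartAt_target x, by
    show e.symm (e x) ∈ O
    rwa [e.left_inv (mem_extChartAt_source x)]⟩
  have hβ := contMDiff_chartParam (x := x) (V := V) hV
  have hβO : ∀ z, chartParam x V z ∈ O := fun z ↦ z.2.2
  have hsβ : ContMDiff (𝓡 m) (𝓡 m) ∞ (s ∘ chartParam x V) := by
    rw [← contMDiffOn_univ]
    exact hs.comp hβ.contMDiffOn fun z _ ↦ hβO z
  have h1 : F.proj ∘ (s ∘ chartParam x V) = F.proj ∘ chartParam x V :=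
    funext fun z ↦ hproj _ (hβO z)
  have h2 : F.component θ hsβ = F.component θ hβ := by
    have : (⟨_, F.isPlot_proj_comp hsβ⟩ : F.quotientDiffeology.Plots V) =
      ⟨_, F.isPlot_proj_comp hβ⟩ := Subtype.ext h1
    exact congrArg (fun α ↦ (θ.1 m V α).1) this
  rw [← F.pullback_descent, ← F.pullback_descent] at h2
  have h3 : F.descent θ x = pullback (k := m) s (F.descent θ) x := by
    refine eq_of_pullback_chartParam_eq hV hxV ?_
    rw [← congrFun h2 ⟨_, hxV⟩]
    exact pullback_comp ((hs.contMDiffAt (hO.mem_nhds (hβO _))).mdifferentiableAt (by simp))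
      ((hβ _).mdifferentiableAt (by simp)) _
  rw [h3]
  exact ContinuousAlternatingMap.map_coord_zero (F.descent θ (s x)) i (hker _ hv)

/-- The map `B` from forms of the quotient diffeology to basic forms. -/
def descentₗ (r : ℕ) : F.quotientDiffeology.forms r →ₗ[ℝ] F.basicForms r where
  toFun θ := ⟨⟨F.descent θ, F.isSmoothForm_descent θ⟩, fun X hX ↦
    ⟨(F.vanishesOnTangent_descent θ).interiorVanishes hX, by
      show InteriorVanishes X (extD (F.descent θ))
      rw [F.extD_descent θ]
      exact (F.vanishesOnTangent_descent _).interiorVanishes hX⟩⟩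
  map_add' θ₁ θ₂ := by
    refine Subtype.ext (Subtype.ext (ext_of_pullback_eq fun U β hβ ↦ ?_))
    refine (F.pullback_descent (θ₁ + θ₂) hβ).trans ?_
    exact congrArg₂ (· + ·) (F.pullback_descent θ₁ hβ).symm (F.pullback_descent θ₂ hβ).symm
  map_smul' c θ := by
    refine Subtype.ext (Subtype.ext (ext_of_pullback_eq fun U β hβ ↦ ?_))
    refine (F.pullback_descent (c • θ) hβ).trans ?_
    exact congrArg (c • ·) (F.pullback_descent θ hβ).symm

theorem descentₗ_injective (r : ℕ) : Function.Injective (F.descentₗ r) := by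
  rw [injective_iff_map_eq_zero]
  intro θ hθ
  have h0 : F.descent θ = 0 := congrArg (fun η : F.basicForms r ↦ η.1.1) hθ
  refine Subtype.ext (funext fun n ↦ funext fun U ↦ funext fun α ↦ Subtype.ext (funext fun t ↦ ?_))
  obtain ⟨V, hV, htV, β, hβ, hαβ⟩ := α.2 t
  have h1 := Diffeology.forms_apply_eq_pullback θ α ⟨_, F.isPlot_proj_comp hβ⟩
    (contMDiff_inclusion hV) hαβ.symm
  have h2 := F.pullback_descent θ hβ
  rw [h0] at h2
  exact (pullback_inclusion hV _ ⟨t.1, htV⟩).symm.trans (congrFun (h2.trans h1) ⟨t.1, htV⟩).symm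

end Descent

/-! ### From basic forms to forms of the quotient diffeology -/

/-- The family of forms on plots determined by a form `η` on `M`: at `t`, the component at `α` is the
value of `β^* η` for a local lift `β` of `α` around `t`, chosen separately for each `t`. -/
def ascent (η : AltField m M r) {U : Opens (Euc n)} (α : F.quotientDiffeology.Plots U) :
    AltField n U r := fun t ↦
  (pullback (k := n) (α.2 t).choose_spec.choose_spec.2.choose η
    ⟨t.1, (α.2 t).choose_spec.choose_spec.1⟩ : Euc n [⋀^Fin r]→L[ℝ] ℝ)

theorem exists_ascent_eq (η : AltField m M r) {U : Opens (Euc n)}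
    (α : F.quotientDiffeology.Plots U) (t : U) :
    ∃ (V : Opens (Euc n)) (hV : V ≤ U) (ht : t.1 ∈ V) (β : V → M), ContMDiff (𝓡 n) (𝓡 m) ∞ β ∧
      α.1 ∘ Opens.inclusion hV = F.proj ∘ β ∧
        (F.ascent η α t : Euc n [⋀^Fin r]→L[ℝ] ℝ) = pullback (k := n) β η ⟨t.1, ht⟩ :=
  ⟨_, (α.2 t).choose_spec.choose, (α.2 t).choose_spec.choose_spec.1, _,
    (α.2 t).choose_spec.choose_spec.2.choose_spec.1,
    (α.2 t).choose_spec.choose_spec.2.choose_spec.2, rfl⟩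

variable [IsManifold (𝓡 m) ∞ M]

variable {F} in
/-- For a `Q`-foliation the components do not depend on the choice of local lifts. With `h` the
identity or an inclusion, this identifies the component at `α` with `γ^* η` for any lift `γ`; for
general `h` it contains the compatibility with smooth changes of parameters. -/
theorem IsQFoliation.pullback_ascent (hF : F.IsQFoliation) {η : AltField m M r}
    (hη : IsSmoothForm η) (h₀ : F.VanishesOnTangent η) (h₁ : F.VanishesOnTangent (extD η))
    {U : Opens (Euc n)} (α : F.quotientDiffeology.Plots U) {V : Opens (Euc k)} {h : V → U}
    (hh : ContMDiff (𝓡 k) (𝓡 n) ∞ h) {γ : V → M} (hγ : ContMDiff (𝓡 k) (𝓡 m) ∞ γ)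
    (hγα : F.proj ∘ γ = α.1 ∘ h) :
    pullback (k := k) h (F.ascent η α) = pullback (k := k) γ η := by
  funext s
  obtain ⟨W, hW, hsW, β, hβ, hβα, hval⟩ := F.exists_ascent_eq η α (h s)
  have hc : Continuous (Subtype.val ∘ h) := continuous_subtype_val.comp hh.continuous
  set V' := preimageOpens hc W with hV'
  have hle : V' ≤ V := preimageOpens_le hc W
  have hs : s.1 ∈ V' := ⟨s, hsW, rfl⟩
  let g : V' → W := fun x ↦ ⟨_, apply_inclusion_preimageOpens_mem hc W x⟩
  have hhi : ContMDiff (𝓡 k) (𝓡 n) ∞ (h ∘ Opens.inclusion hle) := hh.comp (contMDiff_inclusion hle)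
  have hg' : ContMDiff (𝓡 k) (𝓡 n) ∞ (Subtype.val ∘ g) :=
    (contMDiff_subtype_val (U := U)).comp hhi
  have hg : ContMDiff (𝓡 k) (𝓡 n) ∞ g := (ContMDiff.subtypeVal_comp_iff W _).1 hg'
  have hgi : Opens.inclusion hW ∘ g = h ∘ Opens.inclusion hle := rfl
  have h2 : pullback (k := k) (β ∘ g) η = pullback (k := k) (γ ∘ Opens.inclusion hle) η := by
    refine hF.pullback_eq hη h₀ h₁ (hβ.comp hg) (hγ.comp (contMDiff_inclusion hle)) ?_
    rw [← Function.comp_assoc, ← hβα, ← Function.comp_assoc, hγα, Function.comp_assoc, hgi]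
    rfl
  have h3 : pullback (k := k) (β ∘ g) η ⟨s.1, hs⟩ =
      pullback (k := k) g (pullback (k := n) β η) ⟨s.1, hs⟩ :=
    pullback_comp ((hβ _).mdifferentiableAt (by simp)) ((hg _).mdifferentiableAt (by simp)) η
  have h4 : pullback (k := k) (Opens.inclusion hW ∘ g) (F.ascent η α) ⟨s.1, hs⟩ =
      pullback (k := k) g (pullback (k := n) (Opens.inclusion hW) (F.ascent η α)) ⟨s.1, hs⟩ :=
    pullback_comp ((contMDiff_inclusion (n := ∞) hW _).mdifferentiableAt (by simp))
      ((hg _).mdifferentiableAt (by simp)) _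
  have h5 : pullback (k := n) (Opens.inclusion hW) (F.ascent η α) ⟨(h s).1, hsW⟩ =
      pullback (k := n) β η ⟨(h s).1, hsW⟩ :=
    (pullback_inclusion hW _ _).trans hval
  have h6 : pullback (k := k) g (pullback (k := n) (Opens.inclusion hW) (F.ascent η α)) ⟨s.1, hs⟩ =
      pullback (k := k) g (pullback (k := n) β η) ⟨s.1, hs⟩ :=
    congrArg (fun ψ : Euc n [⋀^Fin r]→L[ℝ] ℝ ↦
      ψ.compContinuousLinearMap (mfderiv (𝓡 k) (𝓡 n) g ⟨s.1, hs⟩)) h5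
  refine (pullback_comp_inclusion hle hh (F.ascent η α) ⟨s.1, hs⟩).symm.trans ?_
  refine Eq.trans ?_ (pullback_comp_inclusion hle hγ η ⟨s.1, hs⟩)
  exact h4.trans (h6.trans (h3.symm.trans (congrFun h2 _)))

variable {F} in
theorem IsQFoliation.descentₗ_surjective [T2Space M] (hF : F.IsQFoliation) (r : ℕ) :
    Function.Surjective (F.descentₗ r) := by
  rintro ⟨⟨η, hη⟩, hb⟩
  have h₀ := F.vanishesOnTangent_of_interiorVanishes fun X hX ↦ (hb X hX).1
  have h₁ : F.VanishesOnTangent (extD η) :=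
    F.vanishesOnTangent_of_interiorVanishes fun X hX ↦ (hb X hX).2
  have hsmooth : ∀ {n : ℕ} {U : Opens (Euc n)} (α : F.quotientDiffeology.Plots U),
      IsSmoothForm (F.ascent η α) := by
    intro n U α
    refine isSmoothForm_opens_of_local fun t ↦ ?_
    obtain ⟨V, hV, htV, β, hβ, hαβ⟩ := α.2 t
    refine ⟨V, hV, htV, ?_⟩
    rw [hF.pullback_ascent hη h₀ h₁ α (contMDiff_inclusion hV) hβ hαβ.symm]
    exact IsSmoothForm.pullback hη hβ
  let θ : F.quotientDiffeology.forms r := ⟨fun n U α ↦ ⟨F.ascent η α, hsmooth α⟩, by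
    intro n k U V α h hh
    funext s
    obtain ⟨W, hW, hsW, β, hβ, hβα, hval⟩ := F.exists_ascent_eq η
      ⟨α.1 ∘ h, F.quotientDiffeology.comp_mem α.2 V h hh⟩ s
    refine hval.trans ?_
    have h2 := hF.pullback_ascent hη h₀ h₁ α (hh.comp (contMDiff_inclusion hW)) hβ hβα.symm
    exact (congrFun h2 ⟨s.1, hsW⟩).symm.trans (pullback_comp_inclusion hW hh _ ⟨s.1, hsW⟩)⟩
  refine ⟨θ, Subtype.ext (Subtype.ext (ext_of_pullback_eq fun U β hβ ↦ ?_))⟩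
  refine (F.pullback_descent θ hβ).trans ?_
  have h2 := hF.pullback_ascent hη h₀ h₁ ⟨_, F.isPlot_proj_comp hβ⟩ contMDiff_id hβ rfl
  rw [pullback_id] at h2
  exact h2

end Foliation

end

section

universe u

variable {p q m : ℕ} {M : Type u} [TopologicalSpace M] [ChartedSpace (Euc m) M]

/-! ### The isomorphism of complexes -/

namespace Foliation

/-- The map `B` as a morphism of complexes. -/
def descentHom [IsManifold (𝓡 m) ∞ M] (F : Foliation p q m M) :
    F.quotientDiffeology.deRhamComplex ⟶ F.basicComplex :=
  CochainComplex.ofHom (X := F.quotientDiffeology.deRhamComplex) (Y := F.basicComplex)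
    (fun r ↦ ModuleCat.ofHom (F.descentₗ r)) fun r ↦ by
      simp only [Diffeology.deRhamComplex, basicComplex, CochainComplex.of_d]
      exact ModuleCat.hom_ext
        (LinearMap.ext fun θ ↦ Subtype.ext (Subtype.ext (F.extD_descent θ)))

end Foliation

end

end FoliationCohomology

end

open FoliationCohomology
theorem mainTheorem1 {p q m : ℕ} {M : Type*} [TopologicalSpace M] [ChartedSpace (Euc m) M]
    [IsManifold (𝓡 m) ∞ M] [T2Space M] [SecondCountableTopology M]
    (F : Foliation p q m M) (hF : F.IsQFoliation) :
    ∃ B : F.quotientDiffeology.deRhamComplex ⟶ F.basicComplex,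
      (∀ (r : ℕ) (θ : F.quotientDiffeology.forms r) (n : ℕ) (U : Opens (Euc n)) (β : U → M)
        (hβ : ContMDiff (𝓡 n) (𝓡 m) ∞ β),
        pullback β ((B.f r).hom θ : F.basicForms r).1.1 =
          (θ.1 n U ⟨F.proj ∘ β, F.isPlot_proj_comp hβ⟩).1) ∧
      (∀ r : ℕ, Function.Bijective (B.f r).hom) ∧
      ∀ r : ℕ, CategoryTheory.IsIso (HomologicalComplex.homologyMap B r :
        F.quotientDiffeology.deRhamCohomology r ⟶ F.basicCohomology r) := by
  have hbij : ∀ r, Function.Bijective (F.descentHom.f r).hom := fun r ↦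
    ⟨F.descentₗ_injective r, hF.descentₗ_surjective r⟩
  refine ⟨F.descentHom, fun r θ n U β hβ ↦ F.pullback_descent θ hβ, hbij, fun r ↦ ?_⟩
  have : ∀ r, CategoryTheory.IsIso (F.descentHom.f r) := fun r ↦
    (CategoryTheory.ConcreteCategory.isIso_iff_bijective _).2 (hbij r)
  have : CategoryTheory.IsIso F.descentHom :=
    HomologicalComplex.Hom.isIso_of_components F.descentHom
  exact inferInstanceAs (CategoryTheory.IsIso (HomologicalComplex.homologyMap F.descentHom r))
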